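/- Let $p,k\ge 1$, let $\mathcal S_p(\mathbb R)$ be the space of real symmetric $p\times p$ matrices, and let $$(0_p,I_p)=\{U\in\mathcal S_p(\mathbb R): U \text{ and } I_p-U \text{ are positive definite}\}.$$ A matrix measure on $[0,1]$ is a $p\times p$ matrix $\mu=(\mu_{ab})$ of signed Borel measures such that $\mu(B)$ is symmetric and positive semidefinite for every Borel set $B$. Let $\mathcal M_k(\mathbb R)\subset(\mathcal S_p(\mathbb R))^k$ be the set of all $(S_1,\dots,S_k)$ with $S_j=\int_0^1x^j\,d\mu(x)$, $1\le j\le k$, for some matrix measure $\mu$ on $[0,1]$ with $\mu([0,1])=I_p$, and let $\operatorname{Int}(\mathcal M_k(\mathbb R))$ be its interior in $(\mathcal S_p(\mathbb R))^k$. Put $S_0=I_p$ and define the block Hankel matrices $$\underline H_{2m}=(S_{i+j})_{i,j=0}^{m},\quad \underline H_{2m+1}=(S_{i+j+1})_{i,j=0}^{m},\quad \overline H_{2m}=(S_{i+j+1}-S_{i+j+2})_{i,j=0}^{m-1},\quad \overline H_{2m+1}=(S_{i+j}-S_{i+j+1})_{i,j=0}^{m}$$ and the block rows $$\underline h_{2m}^T=(S_{m+1},\dots,S_{2m}),\qquad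 \underline h_{2m-1}^T=(S_m,\dots,S_{2m-1}),$$ $$\overline h_{2m}^T=(S_m-S_{m+1},\dots,S_{2m-1}-S_{2m}),\qquad \overline h_{2m-1}^T=(S_m-S_{m+1},\dots,S_{2m-2}-S_{2m-1}).$$ Let $S_1^-=0_p$, $S_1^+=I_p$, $S_2^+=S_1$, and $$S_{n+1}^-=\underline h_n^T\,\underline H_{n-1}^{-1}\,\underline h_n\ (n\ge1),\qquad S_{n+1}^+=S_n-\overline h_n^T\,\overline H_{n-1}^{-1}\,\overline h_n\ (n\ge2).$$ The canonical moment map is $\varphi_p(S_1,\dots,S_k)=(U_1,\dots,U_k)$ with $$U_j=(S_j^+-S_j^-)^{-1/2}(S_j-S_j^-)(S_j^+-S_j^-)^{-1/2},\qquad 1\le j\le k.$$ A map $\Phi:\mathcal S\to(\mathbb R^{p\times p})^m$ on an open set $\mathcal S\subset(\mathcal S_p(\mathbb R))^n$ is called matrix differentiable at $\mathbf M^0\in\mathcal S$ with matrix derivative $\mathbf L\in\mathbb R^{mp\times np}$ if $$\Phi(\mathbf M^0+\mathbf H)-\Phi(\mathbf M^0)=\mathbf L\mathbf H+o(\|\mathbf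 H\|)\qquad(\mathbf H\to0 \text{ in } (\mathcal S_p(\mathbb R))^n),$$ where tuples of matrices are regarded as block columns and $\|\cdot\|$ is the Frobenius norm. **Theorem 4.5.** The map $\varphi_p$ is a bijection from $\operatorname{Int}(\mathcal M_k(\mathbb R))$ onto $(0_p,I_p)^k$, and its inverse $\varphi_p^{-1}:(0_p,I_p)^k\to\operatorname{Int}(\mathcal M_k(\mathbb R))$ is matrix differentiable at $\mathbf U^0=(\tfrac12I_p,\dots,\tfrac12I_p)$ with matrix derivative $A\otimes I_p$, where $A=(a_{i,j})\in\mathbb R^{k\times k}$ is the lower triangular matrix with entries $$a_{i,j}=2^{-2i+2}\binom{2i}{i-j}\quad(j\le i),\qquad a_{i,j}=0\quad(j>i).$$ -/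

import Mathlib

open scoped MatrixOrder Kronecker

noncomputable section

/-- The space `𝒮_p(ℝ)` of real symmetric `p × p` matrices. -/
def SymMat (p : ℕ) : Submodule ℝ (Matrix (Fin p) (Fin p) ℝ) where
  carrier := {A | A.IsSymm}
  add_mem' := fun ha hb => ha.add hb
  zero_mem' := Matrix.isSymm_zero
  smul_mem' := fun c _ ha => ha.smul c

/-- A real `p × p` matrix measure on `[0,1]`: a matrix of signed Borel measures such that every
set gets a symmetric positive semidefinite matrix (`PosSemidef` includes symmetry). -/
structure MatrixMeasure (p : ℕ) where
  entry : Fin p → Fin p → MeasureTheory.SignedMeasure unitInterval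
  posSemidef : ∀ B : Set unitInterval, (Matrix.of fun a b => entry a b B).PosSemidef

/-- The `n`-th moment `∫ xⁿ dμ(x)` of a matrix measure, an entrywise integral. -/
def MatrixMeasure.moment {p : ℕ} (μ : MatrixMeasure p) (n : ℕ) : Matrix (Fin p) (Fin p) ℝ :=
  Matrix.of fun a b => MeasureTheory.VectorMeasure.integral (μ.entry a b)
    (fun x : unitInterval => (x : ℝ) ^ n) (ContinuousLinearMap.lsmul ℝ ℝ)

/-- The moment space `𝓜_k(ℝ)`: all `(S_1, …, S_k)` that are the first `k` moments of a matrix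
measure on `[0,1]` normalized by `μ([0,1]) = I_p`. The moment `S_{j+1}` sits at index `j`. -/
def momentSpace (p k : ℕ) : Set (Fin k → SymMat p) :=
  {S | ∃ μ : MatrixMeasure p, μ.moment 0 = 1 ∧
    ∀ j : Fin k, (S j : Matrix (Fin p) (Fin p) ℝ) = μ.moment (j + 1)}

/-- The sequence `S_0 = I_p, S_1, …, S_k` (continued by `0`, which is never used). -/
def momentSeq {p k : ℕ} (S : Fin k → SymMat p) : ℕ → SymMat p
  | 0 => ⟨1, Matrix.isSymm_one⟩
  | n + 1 => if h : n < k then S ⟨n, h⟩ else 0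

/-- The block Hankel matrix with `m × m` blocks `T_{i+j}` of size `p × p`. -/
def blockHankel {p : ℕ} (T : ℕ → SymMat p) (m : ℕ) :
    Matrix (Fin m × Fin p) (Fin m × Fin p) ℝ :=
  Matrix.of fun x y => (T (x.1 + y.1) : Matrix (Fin p) (Fin p) ℝ) x.2 y.2

/-- The block column with blocks `T_0, …, T_{m-1}`. -/
def blockColumn {p : ℕ} (T : ℕ → SymMat p) (m : ℕ) : Matrix (Fin m × Fin p) (Fin p) ℝ :=
  Matrix.of fun x b => (T x.1 : Matrix (Fin p) (Fin p) ℝ) x.2 b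

/-- The matrix `H̲_n`: blocks `S_{i+j}`, `0 ≤ i, j ≤ m`, for `n = 2m`, and blocks `S_{i+j+1}`,
`0 ≤ i, j ≤ m`, for `n = 2m+1`. -/
def lowerHankel {p : ℕ} (s : ℕ → SymMat p) (n : ℕ) :
    Matrix (Fin ((n + 2) / 2) × Fin p) (Fin ((n + 2) / 2) × Fin p) ℝ :=
  blockHankel (fun i => s (i + n % 2)) ((n + 2) / 2)

/-- The matrix `H̅_n`: blocks `S_{i+j+1} - S_{i+j+2}`, `0 ≤ i, j ≤ m-1`, for `n = 2m`, and blocks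
`S_{i+j} - S_{i+j+1}`, `0 ≤ i, j ≤ m`, for `n = 2m+1`. -/
def upperHankel {p : ℕ} (s : ℕ → SymMat p) (n : ℕ) :
    Matrix (Fin ((n + 1) / 2) × Fin p) (Fin ((n + 1) / 2) × Fin p) ℝ :=
  blockHankel (fun i => s (i + (n + 1) % 2) - s (i + (n + 1) % 2 + 1)) ((n + 1) / 2)

/-- The block column `h̲_n`: `(S_{m+1}, …, S_{2m})` for `n = 2m` and `(S_m, …, S_{2m-1})` for
`n = 2m-1`. -/
def lowerColumn {p : ℕ} (s : ℕ → SymMat p) (n : ℕ) :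
    Matrix (Fin ((n + 1) / 2) × Fin p) (Fin p) ℝ :=
  blockColumn (fun i => s (i + n / 2 + 1)) ((n + 1) / 2)

/-- The block column `h̅_n`: `(S_m - S_{m+1}, …, S_{2m-1} - S_{2m})` for `n = 2m` and
`(S_m - S_{m+1}, …, S_{2m-2} - S_{2m-1})` for `n = 2m-1`. -/
def upperColumn {p : ℕ} (s : ℕ → SymMat p) (n : ℕ) :
    Matrix (Fin (n / 2) × Fin p) (Fin p) ℝ :=
  blockColumn (fun i => s (i + (n + 1) / 2) - s (i + (n + 1) / 2 + 1)) (n / 2)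

/-- The lower bound `S_n⁻`: `S_1⁻ = 0` and `S_{n+1}⁻ = h̲_nᵀ H̲_{n-1}⁻¹ h̲_n` for `n ≥ 1`
(the value at `n = 0` is never used). -/
def momentLower {p : ℕ} (s : ℕ → SymMat p) : ℕ → Matrix (Fin p) (Fin p) ℝ
  | 0 => 0
  | 1 => 0
  | n + 2 => (lowerColumn s (n + 1)).transpose * (lowerHankel s n)⁻¹ * lowerColumn s (n + 1)

/-- The upper bound `S_n⁺`: `S_1⁺ = I_p`, `S_2⁺ = S_1`, and `S_{n+1}⁺ = S_n - h̅_nᵀ H̅_{n-1}⁻¹ h̅_n`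
for `n ≥ 2` (the value at `n = 0` is never used). -/
def momentUpper {p : ℕ} (s : ℕ → SymMat p) : ℕ → Matrix (Fin p) (Fin p) ℝ
  | 0 => 0
  | 1 => 1
  | 2 => s 1
  | n + 3 => (s (n + 2) : Matrix (Fin p) (Fin p) ℝ) -
      (upperColumn s (n + 2)).transpose * (upperHankel s (n + 1))⁻¹ * upperColumn s (n + 2)

/-- The matrix `(S_n⁺ - S_n⁻)^{-1/2}`, the inverse of the positive semidefinite square root. -/
def invSqrtRange {p : ℕ} (s : ℕ → SymMat p) (n : ℕ) : Matrix (Fin p) (Fin p) ℝ :=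
  (CFC.sqrt (momentUpper s n - momentLower s n))⁻¹

theorem blockHankel_isSymm {p : ℕ} (T : ℕ → SymMat p) (m : ℕ) : (blockHankel T m).IsSymm := by
  ext x y
  simp only [blockHankel, Matrix.transpose_apply, Matrix.of_apply]
  rw [add_comm]
  exact (T (x.1 + y.1)).2.apply _ _

theorem momentLower_isSymm {p : ℕ} (s : ℕ → SymMat p) (n : ℕ) : (momentLower s n).IsSymm := by
  match n with
  | 0 => exact Matrix.isSymm_zero
  | 1 => exact Matrix.isSymm_zero
  | n + 2 =>
    have h : (lowerHankel s n).transpose = lowerHankel s n := blockHankel_isSymm _ _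
    simp only [momentLower, Matrix.IsSymm, Matrix.transpose_mul, Matrix.transpose_transpose,
      Matrix.transpose_nonsing_inv, h, Matrix.mul_assoc]

theorem invSqrtRange_isSymm {p : ℕ} (s : ℕ → SymMat p) (n : ℕ) : (invSqrtRange s n).IsSymm := by
  have h := Matrix.nonneg_iff_posSemidef.1
    (CFC.sqrt_nonneg (momentUpper s n - momentLower s n))
  have h2 : (CFC.sqrt (momentUpper s n - momentLower s n)).transpose =
      CFC.sqrt (momentUpper s n - momentLower s n) := by
    simpa [Matrix.IsHermitian, Matrix.conjTranspose_eq_transpose_of_trivial] using h.1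
  rw [Matrix.IsSymm, invSqrtRange, Matrix.transpose_nonsing_inv, h2]

/-- The symmetric canonical moments
`U_j = (S_j⁺ - S_j⁻)^{-1/2} (S_j - S_j⁻) (S_j⁺ - S_j⁻)^{-1/2}`, i.e. the map `φ_p` on
`(𝒮_p(ℝ))^k`; it is meaningful on the interior of the moment space. -/
def canonicalMoments {p k : ℕ} (S : Fin k → SymMat p) : Fin k → SymMat p := fun j =>
  ⟨invSqrtRange (momentSeq S) (j + 1) *
      ((S j : Matrix (Fin p) (Fin p) ℝ) - momentLower (momentSeq S) (j + 1)) *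
      invSqrtRange (momentSeq S) (j + 1), by
    have h1 : (invSqrtRange (momentSeq S) (j + 1)).transpose = _ := invSqrtRange_isSymm _ _
    have h2 : (momentLower (momentSeq S) (j + 1)).transpose = _ := momentLower_isSymm _ _
    have h3 : (S j : Matrix (Fin p) (Fin p) ℝ).transpose = _ := (S j).2
    change Matrix.transpose _ = _
    simp only [Matrix.transpose_mul, Matrix.transpose_sub, h1, h2, h3, Matrix.mul_assoc]⟩

/-- The cube `(0_p, I_p)^k` with respect to the Loewner order. -/
def loewnerCube (p k : ℕ) : Set (Fin k → SymMat p) :=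
  {U | ∀ j, (U j : Matrix (Fin p) (Fin p) ℝ).PosDef ∧
    (1 - (U j : Matrix (Fin p) (Fin p) ℝ)).PosDef}

/-- The inverse `φ_p⁻¹` of the canonical moment map, regarded as a map defined on the interior of
the moment space. -/
def invCanonicalMoments (p k : ℕ) : (Fin k → SymMat p) → (Fin k → SymMat p) :=
  Function.invFunOn canonicalMoments (interior (momentSpace p k))

/-- A tuple `(X_1, …, X_n)ᵀ` of `p × p` matrices as an `np × p` block column. -/
def stackColumn {p n : ℕ} (X : Fin n → Matrix (Fin p) (Fin p) ℝ) :
    Matrix (Fin n × Fin p) (Fin p) ℝ :=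
  Matrix.of fun x b => X x.1 x.2 b

/-- The Frobenius norm `√(tr (Xᵀ X))`. -/
def frobNorm {ι κ : Type} [Fintype ι] [Fintype κ] (X : Matrix ι κ ℝ) : ℝ :=
  √(X.transpose * X).trace

/-- `Φ : 𝒮 → (ℝ^{p×p})^m`, with `𝒮 ⊆ (𝒮_p(ℝ))^n` open, is matrix differentiable at `M₀ ∈ 𝒮` with
matrix derivative `L ∈ ℝ^{mp×np}`: `Φ (M₀ + H) - Φ M₀ = L H + o(‖H‖)` as `H → 0`. -/
structure HasMatrixDerivAt {p n m : ℕ} (𝒮 : Set (Fin n → SymMat p))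
    (Φ : (Fin n → SymMat p) → (Fin m → Matrix (Fin p) (Fin p) ℝ))
    (L : Matrix (Fin m × Fin p) (Fin n × Fin p) ℝ) (M₀ : Fin n → SymMat p) : Prop where
  isOpen : IsOpen 𝒮
  mem : M₀ ∈ 𝒮
  isLittleO : Asymptotics.IsLittleO (nhdsWithin 0 {H : Fin n → SymMat p | M₀ + H ∈ 𝒮})
    (fun H => frobNorm (stackColumn (fun i => Φ (M₀ + H) i - Φ M₀ i) -
      L * stackColumn fun i => (H i : Matrix (Fin p) (Fin p) ℝ)))
    (fun H => frobNorm (stackColumn fun i => (H i : Matrix (Fin p) (Fin p) ℝ)))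

/-- The lower triangular `k × k` matrix with entries `a_{i,j} = 2^{-2i+2} (2i choose i-j)`,
`1 ≤ j ≤ i ≤ k`; rows and columns are numbered from `0` here. -/
def arcsineMatrix (k : ℕ) : Matrix (Fin k) (Fin k) ℝ :=
  Matrix.of fun i j => if j ≤ i then
    (2 : ℝ) ^ (-2 * ((i : ℤ) + 1) + 2) * (Nat.choose (2 * ((i : ℕ) + 1)) ((i : ℕ) - (j : ℕ)) : ℝ)
  else 0

/-- The point `U⁰ = (I_p/2, …, I_p/2)`. -/
def cubeCenter (p k : ℕ) : Fin k → SymMat p := fun _ =>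
  ⟨(1 / 2 : ℝ) • (1 : Matrix (Fin p) (Fin p) ℝ), Matrix.isSymm_one.smul _⟩

end

/-! Bijection. By splitting off the last block, a block Hankel matrix is positive definite exactly
when the smaller one and its Schur complement are. These Schur complements are the distances `S_n -
S_n⁻` and `S_n⁺ - S_n`, so the strict inequalities `S_n⁻ < S_n < S_n⁺` for `n ≤ k` amount to
definiteness of four Hankel families (`strictlyBetween_iff_hankelPosDef`). They force the next range
`R = S⁺ - S⁻` to be positive definite (`StrictlyBetween.range_posDef`). Hence `S_n = S_n⁻ + R^{1/2}
U_n R^{1/2}` can be solved index by index, which gives a bijection with the cube. The inequalities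
cut out the interior of the moment space (`interior_momentSpace`): measures have semidefinite Hankel
matrices, and definite Hankel matrices come from an atomic measure found by simultaneous
diagonalization.

Derivative. With `x²` in place of the variable on `[0,1]`, the moments become a functional `Λ` on
even powers, and even and odd Hankel matrices can be treated together. The preimage of the centre is
the arcsine law, with the Chebyshev polynomials as orthogonal polynomials. Monic `T_n` and `U_{n-1}`
as trial vectors in the Schur complements give the exact identities `S_n - S_n⁻ = c_n (1 + Θ_n) - E`
and `S_n⁺ - S_n = c_n (1 - Θ_n) - E'`, where `Θ_n = Λ(T_{2n})`, `c_n = halfRange n`, and `E`, `E'`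
are quadratic in quantities vanishing at the arcsine law. Thus the range is the scalar `2 c_n` to
first order, and so is its square root up to the factor `√`; noncommutativity plays no role, and
`U_n = 1/2 + W_n` yields `Θ_n = 2 W_n + o(‖W‖)` (`evenFunctional_T_sub_littleO`). Expanding `x^{2i}`
in Chebyshev polynomials (`sub_arcsineSeq_eq_sum`) turns this into `dS_i = 2^{-2i} ∑_{j ≤ i} 4 (2i
choose i-j) dU_j`. -/

noncomputable section

/-! ### Schur complements and positive definite block Hankel matrices. -/

theorem Matrix.PosDef.fromBlocks_iff {m n : Type*} [Fintype m] [Fintype n] [DecidableEq m]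
    {A : Matrix m m ℝ} (B : Matrix m n ℝ) (D : Matrix n n ℝ) :
    (Matrix.fromBlocks A B B.transpose D).PosDef ↔
      A.PosDef ∧ (D - B.transpose * A⁻¹ * B).PosDef := by
  rw [← Matrix.conjTranspose_eq_transpose_of_trivial]
  -- Completing the square in `x`: the quadratic form separates into one for `A` and one for the
  -- Schur complement.
  have key : ∀ hA : A.PosDef, ∀ x : m → ℝ, ∀ y : n → ℝ,
      star (Sum.elim x y) ⬝ᵥ (Matrix.fromBlocks A B B.conjTranspose D).mulVec (Sum.elim x y) =
        star (x + (A⁻¹ * B).mulVec y) ⬝ᵥ A.mulVec (x + (A⁻¹ * B).mulVec y) +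
        star y ⬝ᵥ (D - B.conjTranspose * A⁻¹ * B).mulVec y := by
    intro hA x y
    have := hA.isUnit.invertible
    simpa only [Matrix.dotProduct_mulVec] using
      Matrix.schur_complement_eq₁₁ B D x y hA.isHermitian
  constructor
  · intro h
    have hA : A.PosDef := by
      have := h.submatrix (e := Sum.inl) Sum.inl_injective
      simpa using! this
    have := hA.isUnit.invertible
    refine ⟨hA, .of_dotProduct_mulVec_pos
      ((Matrix.IsHermitian.fromBlocks₁₁ _ _ hA.1).1 h.1) fun y hy => ?_⟩
    -- The choice `x = -A⁻¹ B y` kills the first square.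
    have h2 := h.dotProduct_mulVec_pos (x := Sum.elim (-((A⁻¹ * B).mulVec y)) y) (by
      intro h0
      apply hy
      funext i
      simpa using congrFun h0 (Sum.inr i))
    rw [key hA] at h2
    simpa using h2
  · rintro ⟨hA, hD⟩
    refine .of_dotProduct_mulVec_pos
      ((Matrix.IsHermitian.fromBlocks₁₁ _ _ hA.1).2 hD.1) fun z hz => ?_
    obtain ⟨x, y, rfl⟩ : ∃ x y, z = Sum.elim x y := ⟨_, _, (Sum.elim_comp_inl_inr z).symm⟩
    rw [key hA]
    by_cases hy : y = 0
    · subst hy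
      have hx : x ≠ 0 := by
        rintro rfl
        exact hz (Sum.elim_zero_zero)
      simpa using hA.dotProduct_mulVec_pos hx
    · have h1 := hA.posSemidef.dotProduct_mulVec_nonneg (x + (A⁻¹ * B).mulVec y)
      have h2 := hD.dotProduct_mulVec_pos hy
      linarith

/-- Eliminating the other block first. Together, the two eliminations transfer positivity from one
Schur complement to the other, the mechanism behind nondegenerate ranges. -/
theorem Matrix.PosDef.fromBlocks_swap_iff {m n : Type*} [Fintype m] [Fintype n]
    [DecidableEq n] (A : Matrix m m ℝ) (B : Matrix m n ℝ) {D : Matrix n n ℝ} :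
    (Matrix.fromBlocks A B B.transpose D).PosDef ↔
      D.PosDef ∧ (A - B * D⁻¹ * B.transpose).PosDef := by
  have h := Matrix.PosDef.fromBlocks_iff (A := D) B.transpose A
  rw [Matrix.transpose_transpose] at h
  rw [← h]
  constructor
  · intro h
    have := h.submatrix (e := Sum.swap) Sum.swap_leftInverse.injective
    rwa [Matrix.fromBlocks_submatrix_sum_swap_sum_swap] at this
  · intro h
    have := h.submatrix (e := Sum.swap) Sum.swap_leftInverse.injective
    rwa [Matrix.fromBlocks_submatrix_sum_swap_sum_swap] at this

variable {p : ℕ}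

/-- The last block column, without its last block, of the block Hankel matrix of size `m + 1`. -/
def hankelColumn (T : ℕ → SymMat p) (m : ℕ) : Matrix (Fin m × Fin p) (Fin p) ℝ :=
  blockColumn (fun i => T (i + m)) m

/-- The Schur complement of the leading block Hankel matrix of size `m` in the one of size
`m + 1`. -/
def hankelSchur (T : ℕ → SymMat p) (m : ℕ) : Matrix (Fin p) (Fin p) ℝ :=
  (T (2 * m) : Matrix (Fin p) (Fin p) ℝ) -
    (hankelColumn T m).transpose * (blockHankel T m)⁻¹ * hankelColumn T m

/-- The splitting of `m + 1` blocks into the first `m` blocks and the last one. -/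
def blockSnocEquiv (m : ℕ) (α : Type*) : (Fin m × α) ⊕ α ≃ Fin (m + 1) × α where
  toFun := Sum.elim (fun x => (x.1.castSucc, x.2)) (fun a => (Fin.last m, a))
  invFun x := Fin.lastCases (motive := fun _ => (Fin m × α) ⊕ α) (Sum.inr x.2)
    (fun i => Sum.inl (i, x.2)) x.1
  left_inv := by rintro (⟨i, a⟩ | a) <;> simp
  right_inv := by
    rintro ⟨i, a⟩
    refine Fin.lastCases ?_ (fun i => ?_) i <;> simp

theorem blockHankel_succ_submatrix (T : ℕ → SymMat p) (m : ℕ) :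
    (blockHankel T (m + 1)).submatrix (blockSnocEquiv m (Fin p)) (blockSnocEquiv m (Fin p)) =
      Matrix.fromBlocks (blockHankel T m) (hankelColumn T m) (hankelColumn T m).transpose
        (T (2 * m) : Matrix (Fin p) (Fin p) ℝ) := by
  ext x y
  rcases x with ⟨i, a⟩ | a <;> rcases y with ⟨j, b⟩ | b
  · simp [blockSnocEquiv, blockHankel]
  · simp [blockSnocEquiv, blockHankel, hankelColumn, blockColumn]
  · have := (T (j + m)).2.apply b a
    simpa [blockSnocEquiv, blockHankel, hankelColumn, blockColumn, add_comm] using this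
  · simp [blockSnocEquiv, blockHankel, two_mul]

theorem blockHankel_succ_posDef_iff (T : ℕ → SymMat p) (m : ℕ) :
    (blockHankel T (m + 1)).PosDef ↔ (blockHankel T m).PosDef ∧ (hankelSchur T m).PosDef := by
  rw [hankelSchur, ← Matrix.PosDef.fromBlocks_iff, ← blockHankel_succ_submatrix]
  constructor
  · exact fun h => h.submatrix (blockSnocEquiv m (Fin p)).injective
  · intro h
    simpa using h.submatrix (blockSnocEquiv m (Fin p)).symm.injective

theorem blockHankel_zero_posDef (T : ℕ → SymMat p) : (blockHankel T 0).PosDef := by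
  refine .of_dotProduct_mulVec_pos (by ext x; exact x.1.elim0) fun x hx => ?_
  exact absurd (Subsingleton.elim _ _) hx

/-- Iterated elimination of the last block, a block `LDLᵀ` factorization. -/
theorem blockHankel_posDef_iff (T : ℕ → SymMat p) (m : ℕ) :
    (blockHankel T m).PosDef ↔ ∀ i < m, (hankelSchur T i).PosDef := by
  induction m with
  | zero => simp [blockHankel_zero_posDef]
  | succ m ih =>
    rw [blockHankel_succ_posDef_iff, ih]
    constructor
    · rintro ⟨h1, h2⟩ i hi
      rcases Nat.lt_succ_iff_lt_or_eq.1 hi with h | rfl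
      · exact h1 i h
      · exact h2
    · exact fun h => ⟨fun i hi => h i (by omega), h m (by omega)⟩

theorem blockHankel_congr {T T' : ℕ → SymMat p} {m : ℕ} (h : ∀ i, i + 2 ≤ 2 * m → T i = T' i) :
    blockHankel T m = blockHankel T' m := by
  ext x y
  simp only [blockHankel, Matrix.of_apply]
  rw [h _ (by omega)]

/-! ### The bounds as Schur complements -/

/-- Sizes such as `(n + 1) / 2` agree with `m` only propositionally, so the comparison is made for
the `p × p` product, whose type does not involve them. -/
theorem column_hankel_column_congr {C C' T T' : ℕ → SymMat p} {m m' : ℕ} (hm : m = m')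
    (hC : ∀ i, C i = C' i) (hT : ∀ i, T i = T' i) :
    (blockColumn C m).transpose * (blockHankel T m)⁻¹ * blockColumn C m =
      (blockColumn C' m').transpose * (blockHankel T' m')⁻¹ * blockColumn C' m' := by
  obtain rfl := hm
  obtain rfl : C = C' := funext hC
  obtain rfl : T = T' := funext hT
  rfl

theorem sub_momentLower_odd (s : ℕ → SymMat p) (m : ℕ) :
    (s (2 * m + 1) : Matrix (Fin p) (Fin p) ℝ) - momentLower s (2 * m + 1) =
      hankelSchur (fun i => s (i + 1)) m := by
  -- For `m = 0` the Schur complement is empty, which matches the convention `S_1⁻ = 0`.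
  rcases m with _ | m
  · have : hankelColumn (fun i => s (i + 1)) 0 = 0 := by ext x; exact x.1.elim0
    simp [hankelSchur, momentLower, this]
  · rw [hankelSchur]
    congr 1
    change (lowerColumn s (2 * m + 1 + 1)).transpose * (lowerHankel s (2 * m + 1))⁻¹ * _ = _
    apply column_hankel_column_congr
    · omega
    · intro i; congr 1; omega
    · intro i; congr 1; omega

theorem sub_momentLower_even (s : ℕ → SymMat p) (m : ℕ) :
    (s (2 * m + 2) : Matrix (Fin p) (Fin p) ℝ) - momentLower s (2 * m + 2) =
      hankelSchur s (m + 1) := by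
  rw [hankelSchur]
  congr 1
  change (lowerColumn s (2 * m + 1)).transpose * (lowerHankel s (2 * m))⁻¹ * _ = _
  apply column_hankel_column_congr
  · omega
  · intro i; congr 1; omega
  · intro i; congr 1; omega

theorem momentUpper_sub_odd (s : ℕ → SymMat p) (hs : (s 0 : Matrix (Fin p) (Fin p) ℝ) = 1)
    (m : ℕ) :
    momentUpper s (2 * m + 1) - (s (2 * m + 1) : Matrix (Fin p) (Fin p) ℝ) =
      hankelSchur (fun i => s i - s (i + 1)) m := by
  rcases m with _ | m
  · have : hankelColumn (fun i => s i - s (i + 1)) 0 = 0 := by ext x; exact x.1.elim0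
    simp [hankelSchur, momentUpper, this, hs]
  · rw [hankelSchur]
    change (s (2 * m + 2) : Matrix (Fin p) (Fin p) ℝ) -
      (upperColumn s (2 * m + 2)).transpose * (upperHankel s (2 * m + 1))⁻¹ *
        upperColumn s (2 * m + 2) - _ = _
    rw [sub_right_comm, Submodule.coe_sub]
    congr 1
    apply column_hankel_column_congr
    · omega
    · intro i
      have h : i + (2 * m + 2 + 1) / 2 = i + (m + 1) := by omega
      rw [h]
    · intro i
      have h : i + (2 * m + 1 + 1) % 2 = i := by omega
      rw [h]

theorem momentUpper_sub_even (s : ℕ → SymMat p) (m : ℕ) :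
    momentUpper s (2 * m + 2) - (s (2 * m + 2) : Matrix (Fin p) (Fin p) ℝ) =
      hankelSchur (fun i => s (i + 1) - s (i + 2)) m := by
  rcases m with _ | m
  · have : hankelColumn (fun i => s (i + 1) - s (i + 2)) 0 = 0 := by ext x; exact x.1.elim0
    simp [hankelSchur, momentUpper, this]
  · rw [hankelSchur]
    change (s (2 * m + 3) : Matrix (Fin p) (Fin p) ℝ) -
      (upperColumn s (2 * m + 3)).transpose * (upperHankel s (2 * m + 2))⁻¹ *
        upperColumn s (2 * m + 3) - _ = _
    rw [sub_right_comm, Submodule.coe_sub]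
    congr 1
    apply column_hankel_column_congr
    · omega
    · intro i
      have h : i + (2 * m + 3 + 1) / 2 = i + (m + 1) + 1 := by omega
      rw [h]
    · intro i
      have h : i + (2 * m + 2 + 1) % 2 = i + 1 := by omega
      rw [h]

theorem momentLower_congr {s s' : ℕ → SymMat p} {n : ℕ} (h : ∀ i < n, s i = s' i) :
    momentLower s n = momentLower s' n := by
  match n with
  | 0 => rfl
  | 1 => rfl
  | n + 2 =>
    have h1 : lowerColumn s (n + 1) = lowerColumn s' (n + 1) := by
      ext x y
      simp only [lowerColumn, blockColumn, Matrix.of_apply]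
      rw [h _ (by omega)]
    have h2 : lowerHankel s n = lowerHankel s' n :=
      by
      ext x y
      simp only [lowerHankel, blockHankel, Matrix.of_apply]
      rw [h _ (by omega)]
    simp only [momentLower, h1, h2]

theorem momentUpper_congr {s s' : ℕ → SymMat p} {n : ℕ} (h : ∀ i < n, s i = s' i) :
    momentUpper s n = momentUpper s' n := by
  match n with
  | 0 => rfl
  | 1 => rfl
  | 2 => simp only [momentUpper, h 1 (by omega)]
  | n + 3 =>
    have h1 : upperColumn s (n + 2) = upperColumn s' (n + 2) := by
      ext x y
      simp only [upperColumn, blockColumn, Matrix.of_apply]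
      rw [h _ (by omega), h _ (by omega)]
    have h2 : upperHankel s (n + 1) = upperHankel s' (n + 1) := by
      ext x y
      simp only [upperHankel, blockHankel, Matrix.of_apply]
      rw [h _ (by omega), h _ (by omega)]
    simp only [momentUpper, h1, h2, h (n + 2) (by omega)]

/-- The moments `s_1, …, s_n` lie strictly between their lower and upper bounds. -/
def StrictlyBetween (s : ℕ → SymMat p) (n : ℕ) : Prop :=
  ∀ j, 1 ≤ j → j ≤ n → ((s j : Matrix (Fin p) (Fin p) ℝ) - momentLower s j).PosDef ∧
    (momentUpper s j - (s j : Matrix (Fin p) (Fin p) ℝ)).PosDef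

theorem StrictlyBetween.mono {s : ℕ → SymMat p} {n m : ℕ} (h : StrictlyBetween s n)
    (hm : m ≤ n) : StrictlyBetween s m := fun j h1 h2 => h j h1 (h2.trans hm)

theorem StrictlyBetween.congr {s s' : ℕ → SymMat p} {n : ℕ} (h : StrictlyBetween s n)
    (hs : ∀ i ≤ n, s i = s' i) : StrictlyBetween s' n := by
  intro j h1 h2
  rw [← momentLower_congr fun i hi => hs i (by omega), ← hs j h2,
    ← momentUpper_congr fun i hi => hs i (by omega)]
  exact h j h1 h2

/-- The four families of block Hankel matrices of `s_0, …, s_n` are positive definite. -/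
structure HankelPosDef (s : ℕ → SymMat p) (n : ℕ) : Prop where
  lower_even : ∀ m, 2 * m ≤ n → (blockHankel s (m + 1)).PosDef
  lower_odd : ∀ m, 2 * m + 1 ≤ n → (blockHankel (fun i => s (i + 1)) (m + 1)).PosDef
  upper_odd : ∀ m, 2 * m + 1 ≤ n → (blockHankel (fun i => s i - s (i + 1)) (m + 1)).PosDef
  upper_even : ∀ m, 2 * m + 2 ≤ n →
    (blockHankel (fun i => s (i + 1) - s (i + 2)) (m + 1)).PosDef

/-- The distances to the bounds are the successive Schur complements of the four families. The only
further one is `s_0` in the family `s_{i+j}`, and it is the identity. -/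
theorem strictlyBetween_iff_hankelPosDef {s : ℕ → SymMat p}
    (hs : (s 0 : Matrix (Fin p) (Fin p) ℝ) = 1) (n : ℕ) :
    StrictlyBetween s n ↔ HankelPosDef s n := by
  constructor
  · intro h
    constructor
    · intro m hm
      rw [blockHankel_posDef_iff]
      intro i hi
      rcases i with _ | i
      · have : hankelColumn s 0 = 0 := by ext x; exact x.1.elim0
        simp [hankelSchur, hs, this, Matrix.PosDef.one]
      · rw [← sub_momentLower_even]
        exact (h _ (by omega) (by omega)).1
    · intro m hm
      rw [blockHankel_posDef_iff]
      intro i hi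
      rw [← sub_momentLower_odd]
      exact (h _ (by omega) (by omega)).1
    · intro m hm
      rw [blockHankel_posDef_iff]
      intro i hi
      rw [← momentUpper_sub_odd s hs]
      exact (h _ (by omega) (by omega)).2
    · intro m hm
      rw [blockHankel_posDef_iff]
      intro i hi
      rw [← momentUpper_sub_even]
      exact (h _ (by omega) (by omega)).2
  · intro h j h1 h2
    obtain ⟨m, rfl | rfl⟩ : ∃ m, j = 2 * m + 1 ∨ j = 2 * m + 2 := ⟨(j - 1) / 2, by omega⟩
    · rw [sub_momentLower_odd, momentUpper_sub_odd s hs]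
      exact ⟨((blockHankel_posDef_iff _ _).1 (h.lower_odd m h2)) m (by omega),
        ((blockHankel_posDef_iff _ _).1 (h.upper_odd m h2)) m (by omega)⟩
    · rw [sub_momentLower_even, momentUpper_sub_even]
      exact ⟨((blockHankel_posDef_iff _ _).1 (h.lower_even (m + 1) (by omega))) (m + 1)
        (by omega), ((blockHankel_posDef_iff _ _).1 (h.upper_even m h2)) m (by omega)⟩

end

/-! ### Nondegeneracy of the next range, by a flat extension. -/

noncomputable section
variable {p : ℕ}

/-- The rectangular block Hankel matrix with `l × m` blocks `T_{i+j}`. -/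
def rectHankel (T : ℕ → SymMat p) (l m : ℕ) : Matrix (Fin l × Fin p) (Fin m × Fin p) ℝ :=
  Matrix.of fun x y => (T (x.1 + y.1) : Matrix (Fin p) (Fin p) ℝ) x.2 y.2

theorem rectHankel_submatrix (T : ℕ → SymMat p) (l m : ℕ) :
    (rectHankel T l (m + 1)).submatrix id (blockSnocEquiv m (Fin p)) =
      Matrix.fromCols (rectHankel T l m) (blockColumn (fun i => T (i + m)) l) := by
  ext x y
  rcases y with ⟨j, b⟩ | b <;>
    simp [rectHankel, blockSnocEquiv, blockColumn]

/-- A block Hankel matrix with vanishing Schur complement is determined by its first rows. -/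
theorem blockHankel_succ_of_hankelSchur_eq_zero {T : ℕ → SymMat p} {m : ℕ}
    (hT : (blockHankel T m).PosDef) (h : hankelSchur T m = 0) :
    blockHankel T (m + 1) =
      (rectHankel T m (m + 1)).transpose * (blockHankel T m)⁻¹ * rectHankel T m (m + 1) := by
  set e := blockSnocEquiv m (Fin p)
  have hH : (blockHankel T m).transpose = blockHankel T m := blockHankel_isSymm _ _
  have hu : IsUnit (blockHankel T m).det := (Matrix.isUnit_iff_isUnit_det _).1 hT.isUnit
  have hs : (T (2 * m) : Matrix (Fin p) (Fin p) ℝ) =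
      (hankelColumn T m).transpose * (blockHankel T m)⁻¹ * hankelColumn T m := sub_eq_zero.1 h
  -- With the columns split as `[H | h]`, the product has blocks `H`, `h`, `hᵀ` and `hᵀ H⁻¹ h`; the
  -- last is `T_{2m}` by the vanishing of the Schur complement.
  have key : (blockHankel T (m + 1)).submatrix e e =
      ((rectHankel T m (m + 1)).transpose * (blockHankel T m)⁻¹ *
        rectHankel T m (m + 1)).submatrix e e := by
    rw [blockHankel_succ_submatrix, ← Matrix.submatrix_mul_equiv _ _ e (Equiv.refl _) e,
      ← Matrix.submatrix_mul_equiv _ _ e (Equiv.refl _) (Equiv.refl _),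
      ← Matrix.transpose_submatrix]
    simp only [Equiv.coe_refl, Matrix.submatrix_id_id]
    rw [rectHankel_submatrix]
    have h1 : rectHankel T m m = blockHankel T m := rfl
    have h2 : blockColumn (fun i => T (i + m)) m = hankelColumn T m := rfl
    rw [h1, h2, Matrix.transpose_fromCols, Matrix.fromRows_mul, Matrix.fromRows_mul_fromCols,
      ← hs, hH, Matrix.mul_nonsing_inv _ hu, Matrix.one_mul, Matrix.one_mul, Matrix.mul_assoc,
      Matrix.nonsing_inv_mul _ hu, Matrix.mul_one]
  have := congrArg (fun M => M.submatrix e.symm e.symm) key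
  simpa using this

/-- The lower bound as an element of the space of symmetric matrices. -/
def momentLowerSym (s : ℕ → SymMat p) (n : ℕ) : SymMat p := ⟨momentLower s n, momentLower_isSymm s n⟩

/-- Placing the new moment at its lower bound makes the range its distance to the upper bound, a
Schur complement of `G - Wᵀ F⁻¹ W`, where `G = (s_{i+j})`, `F = (s_{i+j+1})` is one block smaller
and `W` is `F` with one more block column. Eliminating in the other order reduces positivity to `G`
and `F - W G⁻¹ Wᵀ = (s_{i+j+1} - s_{i+j+2})`. -/
theorem range_posDef_odd {s : ℕ → SymMat p} (hs : (s 0 : Matrix (Fin p) (Fin p) ℝ) = 1) {m : ℕ}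
    (h : HankelPosDef s (2 * m)) :
    (momentUpper s (2 * m + 1) - momentLower s (2 * m + 1)).PosDef := by
  -- Both bounds at an index depend only on earlier moments, so this change leaves them intact.
  set s' : ℕ → SymMat p := Function.update s (2 * m + 1) (momentLowerSym s (2 * m + 1)) with hs'
  have hlt : ∀ i < 2 * m + 1, s' i = s i := fun i hi =>
    Function.update_of_ne (by omega) _ _
  have htop : (s' (2 * m + 1) : Matrix (Fin p) (Fin p) ℝ) = momentLower s (2 * m + 1) := by
    simp [hs', momentLowerSym]
  have hs0 : (s' 0 : Matrix (Fin p) (Fin p) ℝ) = 1 := by rw [hlt 0 (by omega), hs]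
  rw [← htop, ← momentUpper_congr hlt, momentUpper_sub_odd s' hs0]
  refine ((blockHankel_succ_posDef_iff _ _).1 ?_).2
  -- `s_{i+1} = (s_{i+1} - s_{i+2}) + s_{i+2}`, and the second summand gives a principal submatrix
  -- of `(s_{i+j})`.
  have hF : (blockHankel (fun i => s' (i + 1)) m).PosDef := by
    rw [blockHankel_congr (T' := fun i => s (i + 1)) fun i hi => hlt _ (by omega)]
    rcases m with _ | m
    · exact blockHankel_zero_posDef _
    · have h1 := h.upper_even m (by omega)
      have h2 := (h.lower_even (m + 1) (by omega)).submatrix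
        (e := fun x : Fin (m + 1) × Fin p => (x.1.succ, x.2))
        (fun x y hxy => by
          simp only [Prod.mk.injEq, Fin.succ_inj] at hxy
          exact Prod.ext hxy.1 hxy.2)
      convert h1.add h2 using 1
      ext x y
      simp [blockHankel, show (x.1 : ℕ) + 1 + (y.1 + 1) = x.1 + y.1 + 2 by omega]
  have hflat := blockHankel_succ_of_hankelSchur_eq_zero hF (by
    rw [← sub_momentLower_odd, htop, momentLower_congr hlt, sub_self])
  have hG : (blockHankel s' (m + 1)).PosDef := by
    rw [blockHankel_congr fun i hi => hlt _ (by omega)]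
    exact h.lower_even m le_rfl
  have hsub : blockHankel (fun i => s' i - s' (i + 1)) (m + 1) =
      blockHankel s' (m + 1) - blockHankel (fun i => s' (i + 1)) (m + 1) := by
    ext x y
    simp [blockHankel]
  set W := rectHankel (fun i => s' (i + 1)) m (m + 1) with hW
  rw [hsub, hflat]
  have hswap := Matrix.PosDef.fromBlocks_swap_iff (blockHankel s' (m + 1)) W.transpose
    (D := blockHankel (fun i => s' (i + 1)) m)
  rw [Matrix.transpose_transpose] at hswap
  refine (hswap.1 ?_).2
  have hfst := Matrix.PosDef.fromBlocks_iff (A := blockHankel s' (m + 1)) W.transpose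
    (blockHankel (fun i => s' (i + 1)) m)
  rw [Matrix.transpose_transpose] at hfst
  refine hfst.2 ⟨hG, ?_⟩
  have hWG : W = (blockHankel s' (m + 1)).submatrix
      (fun x : Fin m × Fin p => (x.1.succ, x.2)) id := by
    ext x y
    simp [hW, rectHankel, blockHankel, show (x.1 : ℕ) + 1 + y.1 = x.1 + y.1 + 1 by omega]
  have hu : IsUnit (blockHankel s' (m + 1)).det := (Matrix.isUnit_iff_isUnit_det _).1 hG.isUnit
  -- `W` consists of the block rows `1, …, m` of `G`, so `W G⁻¹` is the same selection of rows of
  -- the identity.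
  have hWGW : W * (blockHankel s' (m + 1))⁻¹ * W.transpose =
      (blockHankel s' (m + 1)).submatrix (fun x : Fin m × Fin p => (x.1.succ, x.2))
        (fun x : Fin m × Fin p => (x.1.succ, x.2)) := by
    have h1 : W * (blockHankel s' (m + 1))⁻¹ =
        (1 : Matrix (Fin (m + 1) × Fin p) (Fin (m + 1) × Fin p) ℝ).submatrix
          (fun x : Fin m × Fin p => (x.1.succ, x.2)) id := by
      rw [hWG, ← Matrix.mul_nonsing_inv _ hu]
      ext x y
      simp [Matrix.mul_apply]
    rw [h1]
    ext x y
    simp only [Matrix.mul_apply, Matrix.submatrix_apply, Matrix.one_apply, Matrix.transpose_apply,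
      id, ite_mul, one_mul, zero_mul, Finset.sum_ite_eq, Finset.mem_univ, if_true, hWG]
    exact (blockHankel_isSymm s' (m + 1)).apply _ _
  rw [hWGW]
  rcases m with _ | m
  · refine .of_dotProduct_mulVec_pos (by ext x; exact x.1.elim0) fun x hx => ?_
    exact absurd (Subsingleton.elim _ _) hx
  · convert h.upper_even m (by omega) using 1
    ext x y
    simp [blockHankel, show (x.1 : ℕ) + 1 + (y.1 + 1) = x.1 + y.1 + 2 by omega]
    rw [hlt _ (by omega), hlt _ (by omega)]

/-- As in the odd case, the flat extension turns the relevant Hankel matrix into `K - K G⁻¹ K`. This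
is a Schur complement of the block matrix with rows `(G, K)` and `(K, K)`; the other one is `G - K`,
which is definite by hypothesis. -/
theorem range_posDef_even {s : ℕ → SymMat p} {m : ℕ} (h : HankelPosDef s (2 * m + 1)) :
    (momentUpper s (2 * m + 2) - momentLower s (2 * m + 2)).PosDef := by
  set s' : ℕ → SymMat p := Function.update s (2 * m + 2) (momentLowerSym s (2 * m + 2)) with hs'
  have hlt : ∀ i < 2 * m + 2, s' i = s i := fun i hi =>
    Function.update_of_ne (by omega) _ _
  have htop : (s' (2 * m + 2) : Matrix (Fin p) (Fin p) ℝ) = momentLower s (2 * m + 2) := by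
    simp [hs', momentLowerSym]
  rw [← htop, ← momentUpper_congr hlt, momentUpper_sub_even s']
  refine ((blockHankel_succ_posDef_iff _ _).1 ?_).2
  set G := blockHankel s' (m + 1) with hG'
  set K := blockHankel (fun i => s' (i + 1)) (m + 1) with hK'
  have hG : G.PosDef := by
    rw [hG', blockHankel_congr fun i hi => hlt _ (by omega)]
    exact h.lower_even m (by omega)
  have hK : K.PosDef := by
    rw [hK', blockHankel_congr (T' := fun i => s (i + 1)) fun i hi => hlt _ (by omega)]
    exact h.lower_odd m (by omega)
  have hKs : K.transpose = K := blockHankel_isSymm _ _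
  have hflat := blockHankel_succ_of_hankelSchur_eq_zero hG (by
    rw [← sub_momentLower_even, htop, momentLower_congr hlt, sub_self])
  have hsub : blockHankel (fun i => s' (i + 1) - s' (i + 2)) (m + 1) = K - K * G⁻¹ * K := by
    have h1 : blockHankel (fun i => s' (i + 1) - s' (i + 2)) (m + 1) =
        K - blockHankel (fun i => s' (i + 2)) (m + 1) := by
      ext x y
      simp [hK', blockHankel]
    rw [h1]
    congr 1
    have h2 : blockHankel (fun i => s' (i + 2)) (m + 1) = (blockHankel s' (m + 1 + 1)).submatrix
        (fun x : Fin (m + 1) × Fin p => (x.1.succ, x.2))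
        (fun x : Fin (m + 1) × Fin p => (x.1.succ, x.2)) := by
      ext x y
      simp [blockHankel, show (x.1 : ℕ) + 1 + (y.1 + 1) = x.1 + y.1 + 2 by omega]
    have h3 : K = (rectHankel s' (m + 1) (m + 1 + 1)).submatrix id
        (fun x : Fin (m + 1) × Fin p => (x.1.succ, x.2)) := by
      ext x y
      simp [hK', blockHankel, rectHankel, add_assoc]
    rw [h2, hflat]
    nth_rw 1 [← hKs]
    rw [h3]
    ext x y
    simp only [Matrix.mul_apply, Matrix.submatrix_apply, Matrix.transpose_apply, id]
    rfl
  rw [hsub]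
  have hfst := Matrix.PosDef.fromBlocks_iff (A := G) K K
  have hswap := Matrix.PosDef.fromBlocks_swap_iff G K (D := K)
  rw [hKs] at hfst hswap
  refine (hfst.1 (hswap.2 ⟨hK, ?_⟩)).2
  rw [Matrix.mul_nonsing_inv _ ((Matrix.isUnit_iff_isUnit_det _).1 hK.isUnit), Matrix.one_mul]
  convert h.upper_odd m le_rfl using 1
  ext x y
  simp [hG', hK', blockHankel]
  rw [hlt _ (by omega), hlt _ (by omega)]

/-- The next moment has a nondegenerate range. -/
theorem StrictlyBetween.range_posDef {s : ℕ → SymMat p}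
    (hs : (s 0 : Matrix (Fin p) (Fin p) ℝ) = 1) {n : ℕ} (h : StrictlyBetween s n) :
    (momentUpper s (n + 1) - momentLower s (n + 1)).PosDef := by
  rw [strictlyBetween_iff_hankelPosDef hs] at h
  obtain ⟨m, rfl | rfl⟩ : ∃ m, n = 2 * m ∨ n = 2 * m + 1 := ⟨n / 2, by omega⟩
  · exact range_posDef_odd hs h
  · exact range_posDef_even h

end

/-! ### Canonical moments as coordinates on the strict inequalities. -/

noncomputable section
variable {p : ℕ}

theorem Matrix.sqrt_isSymm {n : Type*} [Fintype n] [DecidableEq n] (R : Matrix n n ℝ) :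
    (CFC.sqrt R).transpose = CFC.sqrt R := by
  have h := Matrix.nonneg_iff_posSemidef.1 (CFC.sqrt_nonneg R)
  simpa [Matrix.IsHermitian, Matrix.conjTranspose_eq_transpose_of_trivial] using h.1

theorem Matrix.PosDef.sqrt_mul_sqrt {n : Type*} [Fintype n] [DecidableEq n] {R : Matrix n n ℝ} (hR : R.PosDef) :
    CFC.sqrt R * CFC.sqrt R = R :=
  CFC.sqrt_mul_sqrt_self R (Matrix.nonneg_iff_posSemidef.2 hR.posSemidef)

theorem Matrix.PosDef.isUnit_det_sqrt {n : Type*} [Fintype n] [DecidableEq n] {R : Matrix n n ℝ} (hR : R.PosDef) :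
    IsUnit (CFC.sqrt R).det := by
  have h := (Matrix.isUnit_iff_isUnit_det _).1 hR.isUnit
  rw [← hR.sqrt_mul_sqrt, Matrix.det_mul] at h
  exact isUnit_of_mul_isUnit_left h

theorem Matrix.PosDef.conj_symm {n : Type*} [Fintype n] [DecidableEq n] {A X : Matrix n n ℝ} (hA : A.PosDef)
    (hX : X.transpose = X) (hu : IsUnit X.det) : (X * A * X).PosDef := by
  have h := hA.conjTranspose_mul_mul_same (B := X)
    (Matrix.mulVec_injective_iff_isUnit.2 ((Matrix.isUnit_iff_isUnit_det _).2 hu))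
  rwa [Matrix.conjTranspose_eq_transpose_of_trivial, hX] at h

/-- The canonical moment of index `n` of a sequence of moments. -/
def canonicalMoment (s : ℕ → SymMat p) (n : ℕ) : Matrix (Fin p) (Fin p) ℝ :=
  invSqrtRange s n * ((s n : Matrix (Fin p) (Fin p) ℝ) - momentLower s n) * invSqrtRange s n

theorem canonicalMoment_congr {s s' : ℕ → SymMat p} {n : ℕ} (h : ∀ i ≤ n, s i = s' i) :
    canonicalMoment s n = canonicalMoment s' n := by
  rw [canonicalMoment, canonicalMoment, invSqrtRange, invSqrtRange, h n le_rfl,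
    momentLower_congr fun i hi => h i hi.le, momentUpper_congr fun i hi => h i hi.le]

theorem sqrt_mul_canonicalMoment_mul_sqrt {s : ℕ → SymMat p} {n : ℕ}
    (hR : (momentUpper s n - momentLower s n).PosDef) :
    CFC.sqrt (momentUpper s n - momentLower s n) * canonicalMoment s n *
      CFC.sqrt (momentUpper s n - momentLower s n) =
      (s n : Matrix (Fin p) (Fin p) ℝ) - momentLower s n := by
  have hu := hR.isUnit_det_sqrt
  rw [canonicalMoment, invSqrtRange]
  set X := CFC.sqrt (momentUpper s n - momentLower s n)
  rw [show ∀ A : Matrix (Fin p) (Fin p) ℝ, X * (X⁻¹ * A * X⁻¹) * X = (X * X⁻¹) * A * (X⁻¹ * X) from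
    fun A => by simp only [Matrix.mul_assoc], Matrix.mul_nonsing_inv _ hu,
    Matrix.nonsing_inv_mul _ hu, Matrix.one_mul, Matrix.mul_one]

theorem canonicalMoment_eq_iff {s : ℕ → SymMat p} {n : ℕ}
    (hR : (momentUpper s n - momentLower s n).PosDef) (U : Matrix (Fin p) (Fin p) ℝ) :
    canonicalMoment s n = U ↔ (s n : Matrix (Fin p) (Fin p) ℝ) = momentLower s n +
      CFC.sqrt (momentUpper s n - momentLower s n) * U *
        CFC.sqrt (momentUpper s n - momentLower s n) := by
  constructor
  · rintro rfl
    rw [sqrt_mul_canonicalMoment_mul_sqrt hR, add_sub_cancel]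
  · intro h
    have hu := hR.isUnit_det_sqrt
    rw [canonicalMoment, invSqrtRange, h, add_sub_cancel_left]
    set X := CFC.sqrt (momentUpper s n - momentLower s n)
    rw [show X⁻¹ * (X * U * X) * X⁻¹ = (X⁻¹ * X) * U * (X * X⁻¹) by
      simp only [Matrix.mul_assoc], Matrix.mul_nonsing_inv _ hu,
      Matrix.nonsing_inv_mul _ hu, Matrix.one_mul, Matrix.mul_one]

/-- Conjugation by `R^{-1/2}` sends the range `R` to the identity, so the distances to the two
bounds become complementary. -/
theorem one_sub_canonicalMoment {s : ℕ → SymMat p} {n : ℕ}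
    (hR : (momentUpper s n - momentLower s n).PosDef) :
    1 - canonicalMoment s n =
      invSqrtRange s n * (momentUpper s n - (s n : Matrix (Fin p) (Fin p) ℝ)) *
        invSqrtRange s n := by
  have hu := hR.isUnit_det_sqrt
  have h1 : invSqrtRange s n * (momentUpper s n - momentLower s n) * invSqrtRange s n = 1 := by
    rw [invSqrtRange]
    nth_rw 2 [← hR.sqrt_mul_sqrt]
    set X := CFC.sqrt (momentUpper s n - momentLower s n)
    rw [show X⁻¹ * (X * X) * X⁻¹ = (X⁻¹ * X) * (X * X⁻¹) by
      simp only [Matrix.mul_assoc], Matrix.mul_nonsing_inv _ hu,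
      Matrix.nonsing_inv_mul _ hu, Matrix.one_mul]
  rw [← h1, canonicalMoment, ← sub_mul, ← mul_sub]
  congr 2
  abel

theorem StrictlyBetween.canonicalMoment_posDef {s : ℕ → SymMat p}
    {n j : ℕ} (h : StrictlyBetween s n) (h1 : 1 ≤ j) (h2 : j ≤ n) :
    (canonicalMoment s j).PosDef ∧ (1 - canonicalMoment s j).PosDef := by
  obtain ⟨hA, hB⟩ := h j h1 h2
  have hR : (momentUpper s j - momentLower s j).PosDef := by
    convert hB.add hA using 1
    abel
  have hu : IsUnit (invSqrtRange s j).det := by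
    rw [invSqrtRange, Matrix.det_nonsing_inv]
    exact hR.isUnit_det_sqrt.ringInverse
  rw [one_sub_canonicalMoment hR]
  exact ⟨hA.conj_symm (invSqrtRange_isSymm s j) hu, hB.conj_symm (invSqrtRange_isSymm s j) hu⟩

/-- The sequence `s`, changed at `n` such that its canonical moment of index `n` is `U`. -/
def extendMoment (s : ℕ → SymMat p) (n : ℕ) (U : SymMat p) : ℕ → SymMat p :=
  Function.update s n ⟨momentLower s n +
      CFC.sqrt (momentUpper s n - momentLower s n) * (U : Matrix (Fin p) (Fin p) ℝ) *
        CFC.sqrt (momentUpper s n - momentLower s n), by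
    refine Matrix.IsSymm.add (momentLower_isSymm s n) ?_
    have hU : (U : Matrix (Fin p) (Fin p) ℝ).transpose = U := U.2
    simp only [Matrix.IsSymm, Matrix.transpose_mul, Matrix.sqrt_isSymm, hU, Matrix.mul_assoc]⟩

theorem extendMoment_of_ne (s : ℕ → SymMat p) {n i : ℕ} (U : SymMat p) (h : i ≠ n) :
    extendMoment s n U i = s i := Function.update_of_ne h _ _

/-- The two new distances are `R^{1/2} U R^{1/2}` and `R^{1/2} (1 - U) R^{1/2}`, congruent to `U`
and `1 - U`; the root is invertible because the range is definite. -/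
theorem StrictlyBetween.extendMoment {s : ℕ → SymMat p}
    (hs : (s 0 : Matrix (Fin p) (Fin p) ℝ) = 1) {n : ℕ} (h : StrictlyBetween s n) {U : SymMat p}
    (hU : (U : Matrix (Fin p) (Fin p) ℝ).PosDef) (hU' : (1 - (U : Matrix (Fin p) (Fin p) ℝ)).PosDef) :
    StrictlyBetween (extendMoment s (n + 1) U) (n + 1) ∧
      canonicalMoment (_root_.extendMoment s (n + 1) U) (n + 1) = U := by
  set s' := _root_.extendMoment s (n + 1) U with hs'
  have hlt : ∀ i < n + 1, s i = s' i := fun i hi => (extendMoment_of_ne s U (by omega)).symm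
  have hR := h.range_posDef hs
  have hl := momentLower_congr hlt
  have hu := momentUpper_congr hlt
  have htop : (s' (n + 1) : Matrix (Fin p) (Fin p) ℝ) = momentLower s' (n + 1) +
      CFC.sqrt (momentUpper s' (n + 1) - momentLower s' (n + 1)) * U *
        CFC.sqrt (momentUpper s' (n + 1) - momentLower s' (n + 1)) := by
    rw [← hl, ← hu]
    simp [hs', _root_.extendMoment]
  rw [hl, hu] at hR
  have hX := hR.isUnit_det_sqrt
  have hXs := Matrix.sqrt_isSymm (momentUpper s' (n + 1) - momentLower s' (n + 1))
  refine ⟨fun j h1 h2 => ?_, (canonicalMoment_eq_iff hR _).2 htop⟩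
  rcases Nat.lt_or_eq_of_le h2 with h3 | rfl
  · exact h.congr (fun i hi => hlt i (by omega)) j h1 (by omega)
  · constructor
    · rw [htop, add_sub_cancel_left]
      exact hU.conj_symm hXs hX
    · rw [htop]
      convert hU'.conj_symm hXs hX using 1
      rw [mul_sub, sub_mul, mul_one, hR.sqrt_mul_sqrt]
      abel

theorem momentSeq_zero {k : ℕ} (S : Fin k → SymMat p) :
    (momentSeq S 0 : Matrix (Fin p) (Fin p) ℝ) = 1 := rfl

theorem momentSeq_succ {k : ℕ} (S : Fin k → SymMat p) (j : Fin k) :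
    momentSeq S (j + 1) = S j := by
  simp [momentSeq]

theorem exists_strictlyBetween {n : ℕ} {U : ℕ → SymMat p}
    (hU : ∀ j, 1 ≤ j → j ≤ n → (U j : Matrix (Fin p) (Fin p) ℝ).PosDef ∧
      (1 - (U j : Matrix (Fin p) (Fin p) ℝ)).PosDef) :
    ∃ s : ℕ → SymMat p, (s 0 : Matrix (Fin p) (Fin p) ℝ) = 1 ∧ StrictlyBetween s n ∧
      ∀ j, 1 ≤ j → j ≤ n → canonicalMoment s j = U j := by
  induction n with
  | zero =>
    exact ⟨fun _ => ⟨1, Matrix.isSymm_one⟩, rfl, fun j h1 h2 => by omega,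
      fun j h1 h2 => by omega⟩
  | succ n ih =>
    obtain ⟨s, hs, h1, h2⟩ := ih fun j hj hj' => hU j hj (by omega)
    obtain ⟨h3, h4⟩ := h1.extendMoment hs (hU (n + 1) (by omega) le_rfl).1
      (hU (n + 1) (by omega) le_rfl).2
    refine ⟨extendMoment s (n + 1) (U (n + 1)), ?_, h3, fun j hj hj' => ?_⟩
    · rw [extendMoment_of_ne _ _ (by omega), hs]
    · rcases Nat.lt_or_eq_of_le hj' with h5 | rfl
      · rw [← h2 j hj (by omega)]
        exact canonicalMoment_congr fun i hi => extendMoment_of_ne _ _ (by omega)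
      · exact h4

theorem momentSeq_of_seq {k : ℕ} {s : ℕ → SymMat p} (hs : (s 0 : Matrix (Fin p) (Fin p) ℝ) = 1)
    {i : ℕ} (hi : i ≤ k) : momentSeq (fun j : Fin k => s (j + 1)) i = s i := by
  rcases i with _ | i
  · exact Subtype.ext hs.symm
  · simp only [momentSeq]
    rw [dif_pos (by omega)]

theorem coe_canonicalMoments {k : ℕ} (S : Fin k → SymMat p) (j : Fin k) :
    (canonicalMoments S j : Matrix (Fin p) (Fin p) ℝ) = canonicalMoment (momentSeq S) (j + 1) := by
  rw [canonicalMoment, momentSeq_succ]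
  rfl

/-- The canonical moment map is a bijection from the moments lying strictly between their bounds
onto the cube. -/
theorem bijOn_canonicalMoments_strictlyBetween (p k : ℕ) :
    Set.BijOn canonicalMoments {S : Fin k → SymMat p | StrictlyBetween (momentSeq S) k}
      (loewnerCube p k) := by
  refine ⟨fun S hS j => ?_, fun S hS S' hS' h => ?_, fun U hU => ?_⟩
  · rw [coe_canonicalMoments]
    exact StrictlyBetween.canonicalMoment_posDef hS (by omega) (by omega)
  -- Earlier moments fix both bounds, hence the canonical moment fixes the next moment.
  · have key : ∀ n ≤ k, momentSeq S n = momentSeq S' n := by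
      intro n
      induction n using Nat.strong_induction_on with
      | _ n ih =>
        intro hn
        rcases n with _ | n
        · rfl
        have hR := (StrictlyBetween.mono hS (show n ≤ k by omega)).range_posDef (momentSeq_zero S)
        have hR' := (StrictlyBetween.mono hS' (show n ≤ k by omega)).range_posDef
          (momentSeq_zero S')
        have hlt : ∀ i < n + 1, momentSeq S i = momentSeq S' i := fun i hi =>
          ih i hi (by omega)
        have e1 := (canonicalMoment_eq_iff hR _).1 rfl
        have e2 := (canonicalMoment_eq_iff hR' _).1 rfl
        have e3 : canonicalMoment (momentSeq S) (n + 1) = canonicalMoment (momentSeq S') (n + 1) := by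
          have := congrArg Subtype.val (congrFun h ⟨n, hn⟩)
          rwa [coe_canonicalMoments, coe_canonicalMoments] at this
        apply Subtype.ext
        rw [e1, e2, e3, momentLower_congr hlt, momentUpper_congr hlt]
    funext j
    rw [← momentSeq_succ S, ← momentSeq_succ S']
    exact key _ (by omega)
  -- `momentSeq U` only serves to number the tuple from `1`; its value at `0` is not used.
  · obtain ⟨s, hs, h1, h2⟩ := exists_strictlyBetween (n := k) (U := momentSeq U)
      (fun j hj hj' => by
        obtain ⟨i, rfl⟩ : ∃ i, j = i + 1 := ⟨j - 1, by omega⟩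
        rw [show momentSeq U (i + 1) = U ⟨i, hj'⟩ from momentSeq_succ U ⟨i, hj'⟩]
        exact hU _)
    refine ⟨fun j => s (j + 1), h1.congr fun i hi => (momentSeq_of_seq hs hi).symm, ?_⟩
    funext j
    apply Subtype.ext
    rw [coe_canonicalMoments, canonicalMoment_congr
      fun i hi => momentSeq_of_seq hs (hi.trans (Nat.succ_le_of_lt j.2)),
      h2 _ (by omega) (by omega), momentSeq_succ]

end

/-! ### Moments of matrix measures have positive semidefinite Hankel matrices. -/

noncomputable section
variable {p : ℕ}

open MeasureTheory in
theorem MeasureTheory.SignedMeasure.isFiniteMeasure_variation {X : Type*} [MeasurableSpace X]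
    (μ : SignedMeasure X) : IsFiniteMeasure (VectorMeasure.variation μ) := by
  rw [← SignedMeasure.totalVariation_eq_variation, SignedMeasure.totalVariation]
  infer_instance

open MeasureTheory in
theorem MeasureTheory.SignedMeasure.integrable_of_continuous {X : Type*} [TopologicalSpace X]
    [CompactSpace X] [MeasurableSpace X] [OpensMeasurableSpace X]
    (μ : SignedMeasure X) {f : X → ℝ} (hf : Continuous f) : VectorMeasure.Integrable μ f := by
  have := μ.isFiniteMeasure_variation
  exact hf.integrable_of_hasCompactSupport (HasCompactSupport.of_compactSpace f)

open MeasureTheory in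
theorem MeasureTheory.SignedMeasure.integral_comp_simpleFunc {X Y : Type*} [MeasurableSpace X]
    (μ : SignedMeasure X) (φ : SimpleFunc X Y) (g : Y → ℝ) :
    VectorMeasure.integral μ (fun x => g (φ x)) (ContinuousLinearMap.lsmul ℝ ℝ) =
      ∑ y ∈ φ.range, g y * μ (φ ⁻¹' {y}) := by
  classical
  have := μ.isFiniteMeasure_variation
  have h1 : (fun x => g (φ x)) = fun x => ∑ y ∈ φ.range, (φ ⁻¹' {y}).indicator (fun _ => g y) x := by
    funext x
    rw [Finset.sum_eq_single (φ x)]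
    · simp
    · intro b _ hb
      simp [Set.indicator, hb.symm]
    · intro h
      exact absurd (φ.mem_range_self x) h
  rw [h1, VectorMeasure.integral_finsetSum]
  · refine Finset.sum_congr rfl fun y _ => ?_
    rw [VectorMeasure.integral_indicator_const _ (φ.measurableSet_fiber y)]
    simp
  · intro y _
    exact (integrable_const _).indicator (φ.measurableSet_fiber y)

-- Replacing the variable by simple functions and using dominated convergence for the finite
-- variation expresses all entries through values `μ(B)` on a common partition. Only there does the
-- semidefiniteness of `μ(B)` become applicable.
open MeasureTheory Filter in
theorem MeasureTheory.SignedMeasure.tendsto_integral_approxOn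
    (μ : SignedMeasure unitInterval) {g : unitInterval → ℝ} (hg : Continuous g) :
    Tendsto (fun N => ∑ y ∈ (SimpleFunc.approxOn id measurable_id Set.univ (0 : unitInterval)
        (Set.mem_univ _) N).range, g y * μ ((SimpleFunc.approxOn id measurable_id Set.univ
        (0 : unitInterval) (Set.mem_univ _) N) ⁻¹' {y})) atTop
      (nhds (VectorMeasure.integral μ g (ContinuousLinearMap.lsmul ℝ ℝ))) := by
  have := μ.isFiniteMeasure_variation
  simp_rw [← SignedMeasure.integral_comp_simpleFunc]
  obtain ⟨C, hC⟩ := (isCompact_range hg).isBounded.exists_norm_le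
  refine VectorMeasure.tendsto_integral_of_dominated_convergence (fun _ => C)
    (fun n => ?_) (integrable_const C) (fun n => ?_) ?_
  · exact (hg.measurable.comp (SimpleFunc.measurable _)).aestronglyMeasurable
  · exact Eventually.of_forall fun t => hC _ ⟨_, rfl⟩
  · refine Eventually.of_forall fun t => (hg.tendsto _).comp ?_
    exact SimpleFunc.tendsto_approxOn (f := id) measurable_id (Set.mem_univ _) (by simp)

namespace MatrixMeasure

variable (μ : MatrixMeasure p)

/-- The entry `∫ f dμ_{ab}` of the integral of a function against a matrix measure. -/
def integralEntry (f : unitInterval → ℝ) (a b : Fin p) : ℝ :=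
  MeasureTheory.VectorMeasure.integral (μ.entry a b) f (ContinuousLinearMap.lsmul ℝ ℝ)

theorem entry_symm (a b : Fin p) : μ.entry a b = μ.entry b a := by
  ext B _
  have := (μ.posSemidef B).1.apply b a
  simpa using this

theorem integralEntry_symm (f : unitInterval → ℝ) (a b : Fin p) :
    μ.integralEntry f a b = μ.integralEntry f b a := by
  rw [integralEntry, entry_symm, integralEntry]

theorem integralEntry_sub {f g : unitInterval → ℝ} (hf : Continuous f) (hg : Continuous g)
    (a b : Fin p) :
    μ.integralEntry (fun t => f t - g t) a b = μ.integralEntry f a b - μ.integralEntry g a b :=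
  MeasureTheory.VectorMeasure.integral_fun_sub
    (MeasureTheory.SignedMeasure.integrable_of_continuous _ hf)
    (MeasureTheory.SignedMeasure.integrable_of_continuous _ hg)

open MeasureTheory Filter in
/-- The weighted block Hankel matrices of a matrix measure are positive semidefinite. -/
theorem posSemidef_hankel {w : unitInterval → ℝ} (hw : Continuous w) (hw0 : ∀ t, 0 ≤ w t)
    (m : ℕ) :
    (Matrix.of fun x y : Fin m × Fin p =>
      μ.integralEntry (fun t => (t : ℝ) ^ ((x.1 : ℕ) + y.1) * w t) x.2 y.2).PosSemidef := by
  refine .of_dotProduct_mulVec_nonneg ?_ fun v => ?_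
  · ext x y
    simp only [Matrix.conjTranspose_apply, Matrix.of_apply, star_trivial]
    rw [integralEntry_symm, add_comm]
  · have hlim : Tendsto (fun N => ∑ x : Fin m × Fin p, ∑ y : Fin m × Fin p, v x * v y *
        ∑ r ∈ (SimpleFunc.approxOn id measurable_id Set.univ (0 : unitInterval)
          (Set.mem_univ _) N).range, ((r : ℝ) ^ ((x.1 : ℕ) + y.1) * w r) *
            μ.entry x.2 y.2 ((SimpleFunc.approxOn id measurable_id Set.univ
              (0 : unitInterval) (Set.mem_univ _) N) ⁻¹' {r})) atTop
        (nhds (∑ x : Fin m × Fin p, ∑ y : Fin m × Fin p, v x * v y *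
          μ.integralEntry (fun t => (t : ℝ) ^ ((x.1 : ℕ) + y.1) * w t) x.2 y.2)) :=
      tendsto_finsetSum _ fun x _ => tendsto_finsetSum _ fun y _ =>
        ((μ.entry x.2 y.2).tendsto_integral_approxOn (by fun_prop)).const_mul _
    have heq : star v ⬝ᵥ (Matrix.of fun x y : Fin m × Fin p =>
        μ.integralEntry (fun t => (t : ℝ) ^ ((x.1 : ℕ) + y.1) * w t) x.2 y.2).mulVec v =
        ∑ x : Fin m × Fin p, ∑ y : Fin m × Fin p, v x * v y *
          μ.integralEntry (fun t => (t : ℝ) ^ ((x.1 : ℕ) + y.1) * w t) x.2 y.2 := by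
      simp only [dotProduct, Matrix.mulVec, Matrix.of_apply, star_trivial, Pi.star_apply,
        Finset.mul_sum]
      refine Finset.sum_congr rfl fun x _ => Finset.sum_congr rfl fun y _ => by ring
    rw [heq]
    refine ge_of_tendsto' hlim fun N => ?_
    set φ := SimpleFunc.approxOn id measurable_id Set.univ (0 : unitInterval) (Set.mem_univ _) N
    -- For each value `r` the double sum is the quadratic form of the matrix mass at the vector
    -- polynomial `∑ v_i r^i`, weighted by `w r`.
    have hswap : ∑ x : Fin m × Fin p, ∑ y : Fin m × Fin p, v x * v y *
        ∑ r ∈ φ.range, ((r : ℝ) ^ ((x.1 : ℕ) + y.1) * w r) * μ.entry x.2 y.2 (φ ⁻¹' {r}) =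
        ∑ r ∈ φ.range, w r * (star (fun a : Fin p => ∑ i : Fin m, v (i, a) * (r : ℝ) ^ (i : ℕ)) ⬝ᵥ
          (Matrix.of fun a b => μ.entry a b (φ ⁻¹' {r})).mulVec
            (fun a : Fin p => ∑ i : Fin m, v (i, a) * (r : ℝ) ^ (i : ℕ))) := by
      simp only [Finset.mul_sum]
      rw [Finset.sum_congr rfl fun x _ => Finset.sum_comm, Finset.sum_comm]
      refine Finset.sum_congr rfl fun r _ => ?_
      simp only [dotProduct, Matrix.mulVec, Matrix.of_apply, star_trivial, Pi.star_apply,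
        Finset.mul_sum, Finset.sum_mul, Fintype.sum_prod_type_right]
      refine Finset.sum_congr rfl fun a _ => ?_
      rw [Finset.sum_comm]
      refine Finset.sum_congr rfl fun b _ => ?_
      rw [Finset.sum_comm]
      refine Finset.sum_congr rfl fun i _ => Finset.sum_congr rfl fun j _ => ?_
      rw [pow_add]
      ring
    rw [hswap]
    exact Finset.sum_nonneg fun r _ => mul_nonneg (hw0 _)
      ((μ.posSemidef _).dotProduct_mulVec_nonneg _)

theorem moment_apply (n : ℕ) (a b : Fin p) :
    μ.moment n a b = μ.integralEntry (fun t => (t : ℝ) ^ n) a b := rfl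

end MatrixMeasure

/-- The four families of block Hankel matrices of `s_0, …, s_n` are positive semidefinite. -/
structure HankelPosSemidef (s : ℕ → SymMat p) (n : ℕ) : Prop where
  lower_even : ∀ m, 2 * m ≤ n → (blockHankel s (m + 1)).PosSemidef
  lower_odd : ∀ m, 2 * m + 1 ≤ n → (blockHankel (fun i => s (i + 1)) (m + 1)).PosSemidef
  upper_odd : ∀ m, 2 * m + 1 ≤ n → (blockHankel (fun i => s i - s (i + 1)) (m + 1)).PosSemidef
  upper_even : ∀ m, 2 * m + 2 ≤ n →
    (blockHankel (fun i => s (i + 1) - s (i + 2)) (m + 1)).PosSemidef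

/-- The four families belong to the weights `1`, `t`, `1 - t` and `t (1 - t)`, all nonnegative on
`[0,1]`. -/
theorem hankelPosSemidef_of_mem_momentSpace {k : ℕ} {S : Fin k → SymMat p}
    (hS : S ∈ momentSpace p k) : HankelPosSemidef (momentSeq S) k := by
  obtain ⟨μ, h0, hμ⟩ := hS
  have hs : ∀ n ≤ k, ∀ a b, (momentSeq S n : Matrix (Fin p) (Fin p) ℝ) a b =
      μ.integralEntry (fun t => (t : ℝ) ^ n) a b := by
    intro n hn a b
    rw [← MatrixMeasure.moment_apply]
    rcases n with _ | n
    · rw [h0, momentSeq_zero]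
    · rw [← hμ ⟨n, hn⟩, ← momentSeq_succ S ⟨n, hn⟩]
  constructor
  · intro m hm
    convert μ.posSemidef_hankel (w := fun _ => 1) continuous_const (fun _ => zero_le_one) (m + 1)
      using 1
    ext x y
    simp [blockHankel, hs _ (show (x.1 : ℕ) + y.1 ≤ k by omega)]
  · intro m hm
    convert μ.posSemidef_hankel (w := fun t => (t : ℝ)) (by fun_prop) (fun t => t.2.1) (m + 1)
      using 1
    ext x y
    simp [blockHankel, hs _ (show (x.1 : ℕ) + y.1 + 1 ≤ k by omega), pow_succ]
  · intro m hm
    convert μ.posSemidef_hankel (w := fun t => 1 - (t : ℝ)) (by fun_prop)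
      (fun t => sub_nonneg.2 t.2.2) (m + 1) using 1
    ext x y
    simp only [blockHankel, Matrix.of_apply, Submodule.coe_sub, Matrix.sub_apply]
    rw [hs _ (show (x.1 : ℕ) + y.1 ≤ k by omega), hs _ (show (x.1 : ℕ) + y.1 + 1 ≤ k by omega),
      ← μ.integralEntry_sub (by fun_prop) (by fun_prop)]
    congr 1
    funext t
    ring
  · intro m hm
    convert μ.posSemidef_hankel (w := fun t => (t : ℝ) * (1 - (t : ℝ))) (by fun_prop)
      (fun t => mul_nonneg t.2.1 (sub_nonneg.2 t.2.2)) (m + 1) using 1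
    ext x y
    simp only [blockHankel, Matrix.of_apply, Submodule.coe_sub, Matrix.sub_apply]
    rw [hs _ (show (x.1 : ℕ) + y.1 + 1 ≤ k by omega), hs _ (show (x.1 : ℕ) + y.1 + 2 ≤ k by omega),
      ← μ.integralEntry_sub (by fun_prop) (by fun_prop)]
    congr 1
    funext t
    ring

end

/-! ### Positive definite Hankel matrices come from an atomic matrix measure. -/

noncomputable section
variable {p : ℕ}

/-- A positive definite matrix `G` and a symmetric matrix `0 ≤ K ≤ G` are simultaneously
congruent to diagonal matrices. -/
theorem Matrix.PosDef.exists_congruence {n : Type*} [Fintype n] [DecidableEq n]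
    {G K : Matrix n n ℝ} (hG : G.PosDef) (hK : K.PosSemidef) (hGK : (G - K).PosSemidef) :
    ∃ (C : Matrix n n ℝ) (t : n → unitInterval), IsUnit C.det ∧ G = C.transpose * C ∧
      K = C.transpose * Matrix.diagonal (fun i => (t i : ℝ)) * C := by
  set R := CFC.sqrt G with hR
  have hRs : R.transpose = R := Matrix.sqrt_isSymm G
  have hRR : R * R = G := hG.sqrt_mul_sqrt
  have hRu : IsUnit R.det := hG.isUnit_det_sqrt
  have hRi : R⁻¹.transpose = R⁻¹ := by rw [Matrix.transpose_nonsing_inv, hRs]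
  set T := R⁻¹ * K * R⁻¹ with hT
  have hTp : T.PosSemidef := by
    have := hK.conjTranspose_mul_mul_same R⁻¹
    rwa [Matrix.conjTranspose_eq_transpose_of_trivial, hRi] at this
  have hTp' : (1 - T).PosSemidef := by
    have := hGK.conjTranspose_mul_mul_same R⁻¹
    rw [Matrix.conjTranspose_eq_transpose_of_trivial, hRi, Matrix.mul_sub, Matrix.sub_mul,
      ← hRR] at this
    rwa [show R⁻¹ * (R * R) * R⁻¹ = (R⁻¹ * R) * (R * R⁻¹) by simp only [Matrix.mul_assoc],
      Matrix.nonsing_inv_mul _ hRu, Matrix.mul_nonsing_inv _ hRu, Matrix.one_mul] at this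
  set V : Matrix n n ℝ := (hTp.1.eigenvectorUnitary : Matrix n n ℝ) with hV
  have hVV : V.transpose * V = 1 := by
    have := Unitary.coe_star_mul_self hTp.1.eigenvectorUnitary
    rwa [Matrix.star_eq_conjTranspose, Matrix.conjTranspose_eq_transpose_of_trivial] at this
  have hVV' : V * V.transpose = 1 := mul_eq_one_comm.1 hVV
  have hD : V.transpose * T * V = Matrix.diagonal hTp.1.eigenvalues := by
    have := hTp.1.conjStarAlgAut_star_eigenvectorUnitary
    rw [Unitary.conjStarAlgAut_star_apply, Matrix.star_eq_conjTranspose,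
      Matrix.conjTranspose_eq_transpose_of_trivial] at this
    exact this
  have h0 : ∀ i, 0 ≤ hTp.1.eigenvalues i := fun i => hTp.eigenvalues_nonneg i
  have h1 : ∀ i, hTp.1.eigenvalues i ≤ 1 := fun i => by
    have := (hTp'.conjTranspose_mul_mul_same V).diag_nonneg (i := i)
    rw [Matrix.conjTranspose_eq_transpose_of_trivial, Matrix.mul_sub, Matrix.sub_mul, hD,
      Matrix.mul_one, hVV] at this
    simpa using this
  refine ⟨V.transpose * R, fun i => ⟨hTp.1.eigenvalues i, h0 i, h1 i⟩, ?_, ?_, ?_⟩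
  · rw [Matrix.det_mul]
    refine IsUnit.mul ?_ hRu
    have := congrArg Matrix.det hVV
    rw [Matrix.det_mul, Matrix.det_one] at this
    exact IsUnit.of_mul_eq_one _ this
  · rw [Matrix.transpose_mul, Matrix.transpose_transpose, hRs,
      show R * V * (V.transpose * R) = R * (V * V.transpose) * R by simp only [Matrix.mul_assoc],
      hVV', Matrix.mul_one, hRR]
  · have e : Matrix.diagonal (fun i => ((⟨hTp.1.eigenvalues i, h0 i, h1 i⟩ : unitInterval) : ℝ)) =
        V.transpose * T * V := by rw [hD]
    rw [e, Matrix.transpose_mul, Matrix.transpose_transpose, hRs,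
      show R * V * (V.transpose * T * V) * (V.transpose * R) =
        R * (V * V.transpose) * T * (V * V.transpose) * R by simp only [Matrix.mul_assoc],
      hVV', Matrix.mul_one, Matrix.mul_one, hT,
      show R * (R⁻¹ * K * R⁻¹) * R = (R * R⁻¹) * K * (R⁻¹ * R) by simp only [Matrix.mul_assoc],
      Matrix.nonsing_inv_mul _ hRu, Matrix.mul_nonsing_inv _ hRu, Matrix.one_mul, Matrix.mul_one]

/-- The atomic matrix measure with mass `c_r c_rᵀ` at the point `t_r`. -/
def atomicMatrixMeasure {ι : Type} [Fintype ι] (t : ι → unitInterval) (c : ι → Fin p → ℝ) :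
    MatrixMeasure p where
  entry a b := ∑ r, MeasureTheory.VectorMeasure.dirac (t r) (c r a * c r b)
  posSemidef B := by
    classical
    -- Vector measures vanish on nonmeasurable sets, hence the measurability condition in the
    -- indicator.
    have h : (Matrix.of fun a b => (∑ r, MeasureTheory.VectorMeasure.dirac (t r)
        (c r a * c r b) : MeasureTheory.SignedMeasure unitInterval) B) =
        ∑ r, (if MeasurableSet B ∧ t r ∈ B then (1 : ℝ) else 0) •
          Matrix.vecMulVec (c r) (star (c r)) := by
      ext a b
      rw [Matrix.of_apply, FunLike.coe_sum, Finset.sum_apply, Matrix.sum_apply]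
      refine Finset.sum_congr rfl fun r _ => ?_
      by_cases hB : MeasurableSet B
      · by_cases hr : t r ∈ B <;> simp [hB, hr, Matrix.vecMulVec_apply]
      · simp [hB, MeasureTheory.VectorMeasure.not_measurable]
    rw [h]
    refine Matrix.posSemidef_sum _ fun r _ => ?_
    exact (Matrix.posSemidef_vecMulVec_self_star _).smul (by split_ifs <;> norm_num)

theorem atomicMatrixMeasure_moment {ι : Type} [Fintype ι] (t : ι → unitInterval)
    (c : ι → Fin p → ℝ) (n : ℕ) (a b : Fin p) :
    (atomicMatrixMeasure t c).moment n a b = ∑ r, (t r : ℝ) ^ n * (c r a * c r b) := by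
  simp only [MatrixMeasure.moment, atomicMatrixMeasure, Matrix.of_apply]
  rw [MeasureTheory.VectorMeasure.integral_finsetSum_vectorMeasure]
  · simp
  · intro r _
    exact MeasureTheory.SignedMeasure.integrable_of_continuous _ (by fun_prop)

/-- Write `G = (s_{i+j}) = Cᵀ C` and `K = (s_{i+j+1}) = Cᵀ D C` with `D` diagonal, entries in
`[0,1]`. The shift between `G` and `K` gives `C_{i+1} = D C_i` for the block columns, so `s_j = C_0ᵀ
D^j C_0`: the moments of the masses `c_r c_rᵀ` at the entries of `D`, where `c_r` is the `r`-th row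
of `C_0`. -/
theorem exists_matrixMeasure_of_hankelPosDef {s : ℕ → SymMat p} {m : ℕ}
    (h : HankelPosDef s (2 * m + 1)) :
    ∃ μ : MatrixMeasure p, ∀ j ≤ 2 * m + 1, μ.moment j = (s j : Matrix (Fin p) (Fin p) ℝ) := by
  have hG := h.lower_even m (by omega)
  have hK := h.lower_odd m le_rfl
  have hGK := h.upper_odd m le_rfl
  have hsub : blockHankel (fun i => s i - s (i + 1)) (m + 1) =
      blockHankel s (m + 1) - blockHankel (fun i => s (i + 1)) (m + 1) := by
    ext x y
    simp [blockHankel]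
  rw [hsub] at hGK
  obtain ⟨C, t, hC, hGC, hKC⟩ := hG.exists_congruence hK.posSemidef hGK.posSemidef
  have hG' : ∀ x y, blockHankel s (m + 1) x y = ∑ r, C r x * C r y := by
    intro x y
    rw [hGC, Matrix.mul_apply]
    rfl
  have hK' : ∀ x y, blockHankel (fun i => s (i + 1)) (m + 1) x y =
      ∑ r, C r x * (t r * C r y) := by
    intro x y
    rw [hKC, Matrix.mul_apply]
    simp only [Matrix.mul_diagonal, Matrix.transpose_apply, mul_assoc]
  have hshift : ∀ (i : ℕ) (hi : i + 1 < m + 1) (r : Fin (m + 1) × Fin p) (a : Fin p),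
      C r (⟨i + 1, hi⟩, a) = t r * C r (⟨i, by omega⟩, a) := by
    intro i hi r a
    -- Column `i + 1` of `G` is column `i` of `K`, and the invertible factor `Cᵀ` cancels.
    have h1 : C.transpose.mulVec (fun r => C r (⟨i + 1, hi⟩, a)) =
        C.transpose.mulVec (fun r => t r * C r (⟨i, by omega⟩, a)) := by
      funext x
      have e1 := hG' x (⟨i + 1, hi⟩, a)
      have e2 := hK' x (⟨i, by omega⟩, a)
      simp only [blockHankel, Matrix.of_apply] at e1 e2
      simp only [Matrix.mulVec, dotProduct, Matrix.transpose_apply]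
      exact e1.symm.trans e2
    exact congrFun (Matrix.mulVec_injective_iff_isUnit.2
      ((Matrix.isUnit_iff_isUnit_det _).2 (by rwa [Matrix.det_transpose])) h1) r
  have hpow : ∀ (i : ℕ) (hi : i < m + 1) (r : Fin (m + 1) × Fin p) (a : Fin p),
      C r (⟨i, hi⟩, a) = t r ^ i * C r (0, a) := by
    intro i
    induction i with
    | zero => intro hi r a; simp
    | succ i ih =>
      intro hi r a
      rw [hshift, ih, pow_succ]
      ring
  refine ⟨atomicMatrixMeasure t fun r a => C r (0, a), fun j hj => ?_⟩
  ext a b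
  rw [atomicMatrixMeasure_moment]
  -- Entries of `G` reach only index `2m`; the top moment is the last block of `K`.
  by_cases hj' : j ≤ 2 * m
  · have e := hG' (⟨j / 2, by omega⟩, a) (⟨j - j / 2, by omega⟩, b)
    simp only [blockHankel, Matrix.of_apply] at e
    rw [show j / 2 + (j - j / 2) = j by omega] at e
    rw [e]
    refine Finset.sum_congr rfl fun r _ => ?_
    rw [hpow (j / 2), hpow (j - j / 2)]
    have : (t r : ℝ) ^ j = (t r : ℝ) ^ (j / 2) * (t r : ℝ) ^ (j - j / 2) := by
      rw [← pow_add]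
      congr 1
      omega
    rw [this]
    ring
  · obtain rfl : j = 2 * m + 1 := by omega
    have e := hK' (⟨m, by omega⟩, a) (⟨m, by omega⟩, b)
    simp only [blockHankel, Matrix.of_apply] at e
    rw [show m + m + 1 = 2 * m + 1 by omega] at e
    rw [e]
    refine Finset.sum_congr rfl fun r _ => ?_
    rw [hpow m _ r a, hpow m _ r b]
    ring

theorem posDef_half : ((1 / 2 : ℝ) • (1 : Matrix (Fin p) (Fin p) ℝ)).PosDef :=
  Matrix.PosDef.one.smul (by norm_num)

theorem one_sub_half : 1 - (1 / 2 : ℝ) • (1 : Matrix (Fin p) (Fin p) ℝ) =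
    (1 / 2 : ℝ) • (1 : Matrix (Fin p) (Fin p) ℝ) := by
  module

/-- The representing measure needs an odd number of moments, so for even `k` one moment with
canonical moment `1/2` is appended. -/
theorem mem_momentSpace_of_strictlyBetween {k : ℕ} {S : Fin k → SymMat p}
    (hS : StrictlyBetween (momentSeq S) k) : S ∈ momentSpace p k := by
  obtain ⟨s, m, hk, hs, hsS⟩ : ∃ (s : ℕ → SymMat p) (m : ℕ), k ≤ 2 * m + 1 ∧
      HankelPosDef s (2 * m + 1) ∧ ∀ i ≤ k, s i = momentSeq S i := by
    obtain ⟨m, hm | hm⟩ : ∃ m, k = 2 * m + 1 ∨ k = 2 * m := ⟨k / 2, by omega⟩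
    · refine ⟨momentSeq S, m, hm.le, ?_, fun _ _ => rfl⟩
      rw [← strictlyBetween_iff_hankelPosDef (momentSeq_zero S), ← hm]
      exact hS
    · subst hm
      have h := (hS.extendMoment (momentSeq_zero S)
        (U := ⟨(1 / 2 : ℝ) • (1 : Matrix (Fin p) (Fin p) ℝ), Matrix.isSymm_one.smul _⟩)
        posDef_half (by
          change (1 - (1 / 2 : ℝ) • (1 : Matrix (Fin p) (Fin p) ℝ)).PosDef
          rw [one_sub_half]
          exact posDef_half)).1
      refine ⟨_, m, by omega, (strictlyBetween_iff_hankelPosDef ?_ _).1 h,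
        fun i hi => extendMoment_of_ne _ _ (by omega)⟩
      rw [extendMoment_of_ne _ _ (by omega)]
      rfl
  obtain ⟨μ, hμ⟩ := exists_matrixMeasure_of_hankelPosDef hs
  refine ⟨μ, ?_, fun j => ?_⟩
  · rw [hμ 0 (by omega), hsS 0 (by omega), momentSeq_zero]
  · rw [hμ _ (by omega), hsS _ (by omega), momentSeq_succ]

end

/-! ### The interior of the moment space. -/

noncomputable section
variable {p : ℕ}

/-- Positivity of the quadratic form on the compact unit sphere persists nearby, and homogeneity
extends it to all nonzero vectors. -/
theorem Matrix.isOpen_setOf_posDef {X n : Type*} [TopologicalSpace X] [Fintype n]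
    {f : X → Matrix n n ℝ} (hf : Continuous f) (hs : ∀ x, (f x).IsSymm) :
    IsOpen {x | (f x).PosDef} := by
  rw [isOpen_iff_eventually]
  intro x hx
  have hcont : Continuous fun z : X × (n → ℝ) => z.2 ⬝ᵥ (f z.1).mulVec z.2 := by fun_prop
  have h := (isCompact_sphere (0 : n → ℝ) 1).eventually_forall_of_forall_eventually (x₀ := x)
    (P := fun x v => 0 < v ⬝ᵥ (f x).mulVec v) (fun v hv => by
      have hv0 : v ≠ 0 := by
        rintro rfl
        simp at hv
      exact (isOpen_lt continuous_const hcont).mem_nhds (hx.dotProduct_mulVec_pos hv0))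
  filter_upwards [h] with y hy
  refine .of_dotProduct_mulVec_pos (by
    rw [Matrix.IsHermitian, Matrix.conjTranspose_eq_transpose_of_trivial, hs y]) fun v hv => ?_
  have hn : 0 < ‖v‖ := norm_pos_iff.2 hv
  have := hy (‖v‖⁻¹ • v) (by
    simp [norm_smul, hn.ne'])
  rw [Matrix.mulVec_smul, smul_dotProduct, dotProduct_smul, smul_eq_mul, smul_eq_mul] at this
  rw [star_trivial]
  exact pos_of_mul_pos_right (pos_of_mul_pos_right this (by positivity)) (by positivity)

theorem continuous_momentSeq {k : ℕ} (n : ℕ) :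
    Continuous fun S : Fin k → SymMat p => momentSeq S n := by
  rcases n with _ | n
  · exact continuous_const
  · simp only [momentSeq]
    split_ifs with h
    · exact continuous_apply _
    · exact continuous_const

theorem continuous_blockHankel {X : Type*} [TopologicalSpace X] {T : X → ℕ → SymMat p}
    (hT : ∀ i, Continuous fun x => T x i) (m : ℕ) :
    Continuous fun x => blockHankel (T x) m :=
  continuous_matrix fun i j =>
    (continuous_subtype_val.comp (hT (i.1 + j.1))).matrix_elem i.2 j.2

theorem isOpen_loewnerCube (p k : ℕ) : IsOpen (loewnerCube p k) := by
  have : loewnerCube p k = ⋂ j : Fin k,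
      {U | (U j : Matrix (Fin p) (Fin p) ℝ).PosDef} ∩
      {U | (1 - (U j : Matrix (Fin p) (Fin p) ℝ)).PosDef} := by
    ext U
    simp [loewnerCube]
  rw [this]
  refine isOpen_iInter_of_finite fun j => (Matrix.isOpen_setOf_posDef ?_ ?_).inter
    (Matrix.isOpen_setOf_posDef ?_ ?_)
  · exact continuous_subtype_val.comp (continuous_apply j)
  · exact fun U => (U j).2
  · exact continuous_const.sub (continuous_subtype_val.comp (continuous_apply j))
  · exact fun U => Matrix.isSymm_one.sub (U j).2

theorem isOpen_hankelPosDef (p k : ℕ) :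
    IsOpen {S : Fin k → SymMat p | HankelPosDef (momentSeq S) k} := by
  rw [isOpen_iff_eventually]
  intro S hS
  have key : ∀ (T : (Fin k → SymMat p) → ℕ → SymMat p) (Q : ℕ → Prop) (N : ℕ),
      (∀ m, Q m → m ≤ N) → (∀ i, Continuous fun S => T S i) →
      (∀ m, Q m → (blockHankel (T S) (m + 1)).PosDef) →
      ∀ᶠ S' in nhds S, ∀ m, Q m → (blockHankel (T S') (m + 1)).PosDef := by
    intro T Q N hN hT h
    refine (Filter.eventually_all_finite (I := {m | Q m})
      ((Set.finite_le_nat N).subset hN)).2 fun m hm => ?_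
    exact (Matrix.isOpen_setOf_posDef (continuous_blockHankel hT (m + 1))
      fun S' => blockHankel_isSymm _ _).mem_nhds (h m hm)
  have hc : ∀ n, Continuous fun S : Fin k → SymMat p => momentSeq S n := continuous_momentSeq
  filter_upwards [key (fun S => momentSeq S) (fun m => 2 * m ≤ k) k (fun m hm => by omega) hc
      hS.lower_even,
    key (fun S i => momentSeq S (i + 1)) (fun m => 2 * m + 1 ≤ k) k (fun m hm => by omega)
      (fun i => hc _) hS.lower_odd,
    key (fun S i => momentSeq S i - momentSeq S (i + 1)) (fun m => 2 * m + 1 ≤ k) k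
      (fun m hm => by omega) (fun i => (hc _).sub (hc _)) hS.upper_odd,
    key (fun S i => momentSeq S (i + 1) - momentSeq S (i + 2)) (fun m => 2 * m + 2 ≤ k) k
      (fun m hm => by omega) (fun i => (hc _).sub (hc _)) hS.upper_even] with S' h1 h2 h3 h4
  exact ⟨h1, h2, h3, h4⟩

/-- Because of `S_0 = I`, `momentSeq` is affine rather than linear; at index `0` the identity holds
since the coefficients on both sides have the same sum. -/
theorem momentSeq_extrapolate {k : ℕ} (S S' : Fin k → SymMat p) (t : ℝ) (n : ℕ) :
    momentSeq (S + t • (S - S')) n + t • momentSeq S' n = (1 + t) • momentSeq S n := by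
  rcases n with _ | n
  · simp only [momentSeq]
    module
  · simp only [momentSeq]
    split_ifs with h
    · simp only [Pi.add_apply, Pi.smul_apply, Pi.sub_apply]
      module
    · simp

theorem posDef_blockHankel_of_extrapolate {T T' T'' : ℕ → SymMat p} {t : ℝ} (ht : 0 < t) (m : ℕ)
    (h : ∀ i, T'' i + t • T' i = (1 + t) • T i) (h' : (blockHankel T' m).PosDef)
    (h'' : (blockHankel T'' m).PosSemidef) : (blockHankel T m).PosDef := by
  have e : blockHankel T m = (1 + t)⁻¹ • (blockHankel T'' m + t • blockHankel T' m) := by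
    have h1 : blockHankel T'' m + t • blockHankel T' m = (1 + t) • blockHankel T m := by
      ext x y
      have := congrArg (fun A : SymMat p => (A : Matrix (Fin p) (Fin p) ℝ) x.2 y.2)
        (h (x.1 + y.1))
      simpa [blockHankel] using this
    rw [h1, smul_smul, inv_mul_cancel₀ (by positivity), one_smul]
  rw [e]
  exact (Matrix.PosDef.posSemidef_add h'' (h'.smul ht)).smul (by positivity)

theorem cubeCenter_mem_loewnerCube (p k : ℕ) : cubeCenter p k ∈ loewnerCube p k := fun _ =>
  ⟨posDef_half, by
    change (1 - (1 / 2 : ℝ) • (1 : Matrix (Fin p) (Fin p) ℝ)).PosDef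
    rw [one_sub_half]
    exact posDef_half⟩

/-- The interior of the moment space is described by strict inequalities. -/
theorem interior_momentSpace (p k : ℕ) :
    interior (momentSpace p k) = {S : Fin k → SymMat p | StrictlyBetween (momentSeq S) k} := by
  have hiff : {S : Fin k → SymMat p | StrictlyBetween (momentSeq S) k} =
      {S : Fin k → SymMat p | HankelPosDef (momentSeq S) k} := by
    ext S
    exact strictlyBetween_iff_hankelPosDef (momentSeq_zero S) k
  apply Set.Subset.antisymm
  · intro S hS
    -- A reference point `S'` with definite Hankel matrices. The segment from `S'` to an interior
    -- point `S` can be prolonged slightly within the moment space, so `S` is a proper convex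
    -- combination of `S'` and a point with semidefinite Hankel matrices.
    obtain ⟨S', hS', -⟩ := (bijOn_canonicalMoments_strictlyBetween p k).surjOn
      (cubeCenter_mem_loewnerCube p k)
    rw [hiff] at hS' ⊢
    have hc : Filter.Tendsto (fun t : ℝ => S + t • (S - S')) (nhdsWithin 0 (Set.Ioi 0))
        (nhds S) := by
      have : Continuous fun t : ℝ => S + t • (S - S') := by fun_prop
      have := (this.tendsto 0).mono_left (nhdsWithin_le_nhds (s := Set.Ioi (0 : ℝ)))
      simpa using this
    obtain ⟨t, hmem, ht⟩ := ((hc.eventually (mem_interior_iff_mem_nhds.1 hS)).and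
      self_mem_nhdsWithin).exists
    have hp := hankelPosSemidef_of_mem_momentSpace hmem
    have he := momentSeq_extrapolate S S' t
    constructor
    · exact fun m hm => posDef_blockHankel_of_extrapolate ht _ he (hS'.lower_even m hm)
        (hp.lower_even m hm)
    · exact fun m hm => posDef_blockHankel_of_extrapolate ht _ (fun i => he (i + 1))
        (hS'.lower_odd m hm) (hp.lower_odd m hm)
    · refine fun m hm => posDef_blockHankel_of_extrapolate ht _ (fun i => ?_)
        (hS'.upper_odd m hm) (hp.upper_odd m hm)
      rw [smul_sub (1 + t), ← he, ← he]
      module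
    · refine fun m hm => posDef_blockHankel_of_extrapolate ht _ (fun i => ?_)
        (hS'.upper_even m hm) (hp.upper_even m hm)
      rw [smul_sub (1 + t), ← he, ← he]
      module
  · refine interior_maximal (fun S hS => mem_momentSpace_of_strictlyBetween hS) ?_
    rw [hiff]
    exact isOpen_hankelPosDef p k

theorem bijOn_canonicalMoments (p k : ℕ) :
    Set.BijOn canonicalMoments (interior (momentSpace p k)) (loewnerCube p k) := by
  rw [interior_momentSpace]
  exact bijOn_canonicalMoments_strictlyBetween p k

end

noncomputable section
variable {p : ℕ}

open Polynomial

/-! ### Chebyshev polynomials -/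

theorem Finset.sum_range_succ_choose_mul {V : Type*} [AddCommGroup V] [Module ℝ V] (f : ℕ → V)
    (a : ℕ) :
    ∑ l ∈ Finset.range (a + 2), ((a + 1).choose l : ℝ) • f l =
      ∑ l ∈ Finset.range (a + 1), (a.choose l : ℝ) • f l +
        ∑ l ∈ Finset.range (a + 1), (a.choose l : ℝ) • f (l + 1) := by
  have h1 : ∑ l ∈ Finset.range (a + 2), (a.choose l : ℝ) • f l =
      ∑ l ∈ Finset.range (a + 1), (a.choose l : ℝ) • f l := by
    rw [Finset.sum_range_succ, Nat.choose_succ_self]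
    simp
  rw [← h1, Finset.sum_range_succ', Finset.sum_range_succ' _ (a + 1)]
  simp only [Nat.choose_succ_succ, Nat.cast_add, add_smul, Finset.sum_add_distrib,
    Nat.choose_zero_right]
  abel

/-- Iterating `x T_n = (T_{n+1} + T_{n-1}) / 2` gives a binomial expansion. It supplies both the
orthogonality relations and the entries of the derivative. -/
theorem Polynomial.Chebyshev.X_pow_mul_T (a : ℕ) (n : ℤ) :
    (X : ℝ[X]) ^ a * Chebyshev.T ℝ n = ((2 : ℝ) ^ a)⁻¹ •
      ∑ l ∈ Finset.range (a + 1), (a.choose l : ℝ) • Chebyshev.T ℝ (n + a - 2 * l) := by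
  induction a generalizing n with
  | zero => simp
  | succ a ih =>
    have hT : (X : ℝ[X]) * Chebyshev.T ℝ n =
        (2 : ℝ)⁻¹ • (Chebyshev.T ℝ (n + 1) + Chebyshev.T ℝ (n - 1)) := by
      have h := Chebyshev.T_add_one ℝ n
      rw [h, sub_add_cancel, mul_assoc, ← C_ofNat, ← smul_eq_C_mul, smul_smul]
      norm_num
    rw [pow_succ, mul_assoc, hT, mul_smul_comm, mul_add, ih, ih, ← smul_add, smul_smul,
      Finset.sum_range_succ_choose_mul]
    congr 1
    · rw [pow_succ, mul_inv, mul_comm]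
    · congr 1
      · refine Finset.sum_congr rfl fun l _ => ?_
        congr 2
        push_cast
        ring
      · refine Finset.sum_congr rfl fun l _ => ?_
        congr 2
        push_cast
        ring

/-- Integration against the arcsine distribution on `[-1, 1]`. -/
def arcsineFunctional : ℝ[X] →ₗ[ℝ] ℝ where
  toFun q := (∫ x, q.eval x ∂Chebyshev.measureT) / Real.pi
  map_add' q r := by
    simp only [eval_add]
    rw [MeasureTheory.integral_add (Chebyshev.integrable_measureT q.continuous.continuousOn)
      (Chebyshev.integrable_measureT r.continuous.continuousOn), add_div]
  map_smul' c q := by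
    simp only [eval_smul, smul_eq_mul, RingHom.id_apply]
    rw [MeasureTheory.integral_const_mul, mul_div_assoc]

theorem arcsineFunctional_T_zero : arcsineFunctional (Chebyshev.T ℝ 0) = 1 := by
  change (∫ x, (Chebyshev.T ℝ 0).eval x ∂Chebyshev.measureT) / Real.pi = 1
  rw [Chebyshev.integral_eval_T_real_measureT_zero, div_self Real.pi_ne_zero]

theorem arcsineFunctional_T {n : ℤ} (hn : n ≠ 0) : arcsineFunctional (Chebyshev.T ℝ n) = 0 := by
  change (∫ x, (Chebyshev.T ℝ n).eval x ∂Chebyshev.measureT) / Real.pi = 0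
  rw [Chebyshev.integral_eval_T_real_measureT_of_ne_zero hn, zero_div]

/-- The hypothesis says that `T_0`, the only Chebyshev polynomial with nonzero integral, is absent
from the expansion. -/
theorem arcsineFunctional_X_pow_mul_T {a : ℕ} {n : ℤ}
    (h : ∀ l : ℕ, l ≤ a → n + a - 2 * l ≠ 0) :
    arcsineFunctional (X ^ a * Chebyshev.T ℝ n) = 0 := by
  rw [Chebyshev.X_pow_mul_T, map_smul, map_sum, Finset.sum_eq_zero, smul_zero]
  intro l hl
  rw [map_smul, arcsineFunctional_T (h l (by simpa [Nat.lt_succ_iff] using hl)), smul_zero]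

theorem Polynomial.basisMonomials_apply_eq_X_pow (n : ℕ) : basisMonomials ℝ n = X ^ n := by
  rw [coe_basisMonomials]
  exact monomial_one_right_eq_X_pow n

/-- The functional on polynomials sending `x^{2i}` to `s_i` and odd powers to `0`. -/
def evenFunctional {V : Type*} [AddCommGroup V] [Module ℝ V] (s : ℕ → V) : ℝ[X] →ₗ[ℝ] V :=
  (basisMonomials ℝ).constr ℝ fun n => if Even n then s (n / 2) else 0

section

variable {V : Type*} [AddCommGroup V] [Module ℝ V]

theorem evenFunctional_X_pow (s : ℕ → V) (n : ℕ) :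
    evenFunctional s (X ^ n) = if Even n then s (n / 2) else 0 := by
  rw [evenFunctional, ← basisMonomials_apply_eq_X_pow, Module.Basis.constr_basis]

theorem evenFunctional_X_pow_two_mul (s : ℕ → V) (i : ℕ) :
    evenFunctional s (X ^ (2 * i)) = s i := by
  rw [evenFunctional_X_pow, if_pos (even_two_mul i), Nat.mul_div_cancel_left _ two_pos]

theorem evenFunctional_sub (s s' : ℕ → V) (q : ℝ[X]) :
    evenFunctional (fun i => s i - s' i) q = evenFunctional s q - evenFunctional s' q := by
  suffices h : evenFunctional (fun i => s i - s' i) = evenFunctional s - evenFunctional s' by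
    rw [h, LinearMap.sub_apply]
  refine (basisMonomials ℝ).ext fun n => ?_
  rw [basisMonomials_apply_eq_X_pow, LinearMap.sub_apply,
    evenFunctional_X_pow, evenFunctional_X_pow, evenFunctional_X_pow]
  split_ifs <;> simp

theorem evenFunctional_eq_sum (s : ℕ → V) {q : ℝ[X]} {N : ℕ} (hq : q.natDegree < N) :
    evenFunctional s q = ∑ i ∈ Finset.range N, q.coeff i • if Even i then s (i / 2) else 0 := by
  conv_lhs => rw [q.as_sum_range_C_mul_X_pow' hq]
  rw [map_sum]
  refine Finset.sum_congr rfl fun i _ => ?_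
  rw [← smul_eq_C_mul, map_smul, evenFunctional_X_pow]

/-- The even moments of the arcsine distribution on `[-1, 1]`. -/
def arcsineMoment (i : ℕ) : ℝ := arcsineFunctional (X ^ (2 * i))

theorem evenFunctional_arcsineMoment (v : V) (q : ℝ[X]) :
    evenFunctional (fun i => arcsineMoment i • v) q = arcsineFunctional q • v := by
  suffices h : evenFunctional (fun i => arcsineMoment i • v) = arcsineFunctional.smulRight v by
    rw [h, LinearMap.smulRight_apply]
  refine (basisMonomials ℝ).ext fun n => ?_
  rw [basisMonomials_apply_eq_X_pow, LinearMap.smulRight_apply,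
    evenFunctional_X_pow]
  split_ifs with h
  · rw [arcsineMoment, Nat.two_mul_div_two_of_even h]
  · have h0 : arcsineFunctional ((X : ℝ[X]) ^ n) = 0 := by
      have := arcsineFunctional_X_pow_mul_T (a := n) (n := 0) fun l _ hl => h ⟨l, by omega⟩
      simpa using this
    rw [h0, zero_smul]

theorem arcsineMoment_zero : arcsineMoment 0 = 1 := by
  rw [arcsineMoment, mul_zero, pow_zero, ← Chebyshev.T_zero ℝ, arcsineFunctional_T_zero]

end

theorem Polynomial.coeff_eq_zero_of_parity {q : ℝ[X]} {n k : ℕ}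
    (hq : ∀ x, q.eval (-x) = (-1) ^ n * q.eval x) (hk : ¬ Even (n + k)) : q.coeff k = 0 := by
  have h : q.comp (C (-1) * X) = C ((-1) ^ n) * q := by
    refine Polynomial.funext fun x => ?_
    simp [hq]
  have h2 := congrArg (fun r => r.coeff k) h
  simp only [comp_C_mul_X_coeff, coeff_C_mul] at h2
  rcases Nat.even_or_odd n with hn | hn <;> rcases Nat.even_or_odd k with hk' | hk'
  · exact absurd (hn.add hk') hk
  · rw [hn.neg_one_pow, hk'.neg_one_pow] at h2
    linarith
  · rw [hn.neg_one_pow, hk'.neg_one_pow] at h2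
    linarith
  · exact absurd (hn.add_odd hk') hk

/-- A polynomial of definite parity has one coefficient per block, so it can serve as a trial vector
for a Hankel matrix in `x²`. -/
theorem Polynomial.eq_sum_of_parity {q : ℝ[X]} {m e : ℕ} (he : e < 2)
    (hq : ∀ x, q.eval (-x) = (-1) ^ (2 * m + e) * q.eval x) (hd : q.natDegree = 2 * m + e) :
    q = ∑ i ∈ Finset.range (m + 1), C (q.coeff (2 * i + e)) * X ^ (2 * i + e) := by
  ext k
  rw [finsetSum_coeff]
  simp only [coeff_C_mul_X_pow]
  by_cases hk : ∃ i < m + 1, k = 2 * i + e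
  · obtain ⟨i, hi, rfl⟩ := hk
    rw [Finset.sum_eq_single i]
    · simp
    · intro j _ hj
      rw [if_neg (by omega)]
    · intro h
      exact absurd (Finset.mem_range.2 hi) h
  · rw [Finset.sum_eq_zero]
    · by_cases hk2 : k ≤ 2 * m + e
      · refine coeff_eq_zero_of_parity hq fun h => hk ⟨(k - e) / 2, ?_, ?_⟩
        · omega
        · obtain ⟨r, hr⟩ := h
          omega
      · exact coeff_eq_zero_of_natDegree_lt (by omega)
    · intro i hi
      rw [if_neg fun h => hk ⟨i, by simpa using hi, h⟩]

/-- The monic Chebyshev polynomial of the first kind of degree `n ≥ 1`. -/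
def monicT (n : ℕ) : ℝ[X] := ((2 : ℝ) ^ (n - 1))⁻¹ • Chebyshev.T ℝ n

/-- The monic Chebyshev polynomial of the second kind. -/
def monicU (n : ℕ) : ℝ[X] := ((2 : ℝ) ^ n)⁻¹ • Chebyshev.U ℝ n

theorem natDegree_monicT (n : ℕ) : (monicT n).natDegree = n := by
  rw [monicT, natDegree_smul _ (by positivity), Chebyshev.natDegree_T, Int.natAbs_natCast]

theorem natDegree_monicU (n : ℕ) : (monicU n).natDegree = n := by
  rw [monicU, natDegree_smul _ (by positivity), Chebyshev.natDegree_U_natCast]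

theorem coeff_monicT (n : ℕ) : (monicT n).coeff n = 1 := by
  have h := Chebyshev.leadingCoeff_T ℝ (n : ℤ)
  rw [leadingCoeff, Chebyshev.natDegree_T, Int.natAbs_natCast] at h
  rw [monicT, coeff_smul, h, smul_eq_mul, inv_mul_cancel₀ (by positivity)]

theorem coeff_monicU (n : ℕ) : (monicU n).coeff n = 1 := by
  have h := Chebyshev.leadingCoeff_U_natCast ℝ n
  rw [leadingCoeff, Chebyshev.natDegree_U_natCast] at h
  rw [monicU, coeff_smul, h, smul_eq_mul, inv_mul_cancel₀ (by positivity)]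

theorem monicT_eval_neg (n : ℕ) (x : ℝ) :
    (monicT n).eval (-x) = (-1) ^ n * (monicT n).eval x := by
  simp only [monicT, eval_smul, Chebyshev.T_eval_neg, smul_eq_mul, Int.cast_negOnePow_natCast]
  ring

theorem monicU_eval_neg (n : ℕ) (x : ℝ) :
    (monicU n).eval (-x) = (-1) ^ n * (monicU n).eval x := by
  simp only [monicU, eval_smul, Chebyshev.U_eval_neg, smul_eq_mul, Int.cast_negOnePow_natCast]
  ring

theorem monicT_sq (n : ℕ) :
    monicT n ^ 2 = (((2 : ℝ) ^ (n - 1))⁻¹ ^ 2 / 2) • (1 + Chebyshev.T ℝ (2 * n)) := by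
  have h := Chebyshev.T_mul_T ℝ n n
  rw [sub_self, Chebyshev.T_zero, ← two_mul] at h
  have h2 : Chebyshev.T ℝ n ^ 2 = (2 : ℝ)⁻¹ • (1 + Chebyshev.T ℝ (2 * n)) := by
    rw [add_comm, ← h, mul_assoc, ← C_ofNat, ← smul_eq_C_mul, smul_smul, sq]
    norm_num
  rw [monicT, _root_.smul_pow, h2, smul_smul, div_eq_mul_inv]

/-- The polynomial form of `cos² + sin² = 1`; the recurrence is the rotation that preserves it. -/
theorem Polynomial.Chebyshev.pell (n : ℕ) :
    Chebyshev.T ℝ (n + 1) ^ 2 + (1 - X ^ 2) * Chebyshev.U ℝ n ^ 2 = 1 := by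
  induction n with
  | zero => simp
  | succ n ih =>
    have h1 := Chebyshev.T_eq_X_mul_T_sub_pol_U ℝ n
    have h2 := Chebyshev.U_eq_X_mul_U_add_T ℝ n
    push_cast
    rw [show (n : ℤ) + 1 + 1 = n + 2 by ring, h1, h2]
    linear_combination ih

/-- With `n = j - 1` the constant is the one in `monicT_sq j`. This makes the linearized distances
to the two bounds symmetric. -/
theorem one_sub_X_sq_mul_monicU_sq (n : ℕ) :
    (1 - X ^ 2) * monicU n ^ 2 =
      (((2 : ℝ) ^ n)⁻¹ ^ 2 / 2) • (1 - Chebyshev.T ℝ (2 * (n + 1 : ℕ))) := by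
  have h := Chebyshev.T_mul_T ℝ (n + 1 : ℤ) (n + 1)
  rw [sub_self, Chebyshev.T_zero, ← two_mul] at h
  have h2 : (1 - X ^ 2) * Chebyshev.U ℝ n ^ 2 =
      (2 : ℝ)⁻¹ • (1 - Chebyshev.T ℝ (2 * (n + 1 : ℕ))) := by
    have h3 : (1 : ℝ[X]) - Chebyshev.T ℝ (2 * (n + 1 : ℕ)) =
        2 * ((1 - X ^ 2) * Chebyshev.U ℝ n ^ 2) := by
      push_cast
      linear_combination h - 2 * Chebyshev.pell n
    rw [h3, ← C_ofNat, ← smul_eq_C_mul, smul_smul]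
    norm_num
  rw [monicU, _root_.smul_pow, mul_smul_comm, h2, smul_smul, div_eq_mul_inv]

theorem arcsineFunctional_X_pow_mul_monicT {a n : ℕ} (h : a < n) :
    arcsineFunctional (X ^ a * monicT n) = 0 := by
  rw [monicT, mul_smul_comm, map_smul, arcsineFunctional_X_pow_mul_T (by omega), smul_zero]

/-- `(1 - x²) U_n = (T_n - T_{n+2}) / 2` reduces this to orthogonality for the first kind. -/
theorem arcsineFunctional_X_pow_mul_monicU {a n : ℕ} (h : a < n) :
    arcsineFunctional ((1 - X ^ 2) * (X ^ a * monicU n)) = 0 := by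
  have h1 : (1 - X ^ 2) * Chebyshev.U ℝ n =
      (2 : ℝ)⁻¹ • (Chebyshev.T ℝ n - Chebyshev.T ℝ (n + 2)) := by
    have h2 := Chebyshev.one_sub_X_sq_mul_U_eq_pol_in_T ℝ n
    have h3 := Chebyshev.T_add_two ℝ (n : ℤ)
    have h4 : Chebyshev.T ℝ n - Chebyshev.T ℝ (n + 2) = 2 * ((1 - X ^ 2) * Chebyshev.U ℝ n) := by
      linear_combination -2 * h2 + h3
    rw [h4, ← C_ofNat, ← smul_eq_C_mul, smul_smul]
    norm_num
  have h5 : (1 - X ^ 2) * (X ^ a * monicU n) = (((2 : ℝ) ^ n)⁻¹ * 2⁻¹) •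
      (X ^ a * Chebyshev.T ℝ n - X ^ a * Chebyshev.T ℝ (n + 2)) := by
    rw [monicU, mul_smul_comm, mul_smul_comm, mul_left_comm, h1, mul_smul_comm, smul_smul, mul_sub]
  rw [h5, map_smul, map_sub, arcsineFunctional_X_pow_mul_T (by omega),
    arcsineFunctional_X_pow_mul_T (by omega), sub_zero, smul_zero]

end

/-! ### Schur complements evaluated with Chebyshev trial polynomials. -/

noncomputable section
variable {p : ℕ}

open Polynomial

/-- Completing the square: the Schur complement of a block Hankel matrix from a trial vector. -/
theorem hankelSchur_eq_sub {T : ℕ → SymMat p} {m : ℕ} (hT : IsUnit (blockHankel T m).det)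
    {v : ℕ → ℝ} (hv : v m = 1) {D : ℕ → SymMat p}
    (hD : ∀ i, D i = ∑ j ∈ Finset.range (m + 1), v j • T (i + j)) :
    hankelSchur T m = ((∑ i ∈ Finset.range (m + 1), v i • D i : SymMat p) :
        Matrix (Fin p) (Fin p) ℝ) -
      (blockColumn D m).transpose * (blockHankel T m)⁻¹ * blockColumn D m := by
  set H := blockHankel T m with hH
  set col := hankelColumn T m with hcol
  set V : Matrix (Fin m × Fin p) (Fin p) ℝ :=
    Matrix.of fun x b => v x.1 * (1 : Matrix (Fin p) (Fin p) ℝ) x.2 b with hV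
  have hHs : H.transpose = H := blockHankel_isSymm _ _
  -- `D` is the Hankel matrix applied to the trial vector. Its first `m` blocks measure the failure
  -- of orthogonality to lower degrees.
  have hDcol : blockColumn D m = col + H * V := by
    ext x b
    rw [Matrix.add_apply, Matrix.mul_apply, Fintype.sum_prod_type]
    simp only [hH, hV, hcol, blockColumn, hankelColumn, blockHankel, Matrix.of_apply, hD,
      Matrix.one_apply, mul_ite, mul_one, mul_zero, Finset.sum_ite_eq', Finset.mem_univ, if_true,
      Finset.sum_range_succ, hv, one_smul, Submodule.coe_add, Matrix.add_apply]
    rw [add_comm, Finset.sum_range]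
    simp [Matrix.sum_apply, mul_comm]
  have hVD : V.transpose * blockColumn D m =
      ((∑ i ∈ Finset.range m, v i • D i : SymMat p) : Matrix (Fin p) (Fin p) ℝ) := by
    ext a b
    rw [Matrix.mul_apply, Fintype.sum_prod_type, Finset.sum_range]
    simp [hV, blockColumn, Matrix.one_apply, Matrix.sum_apply]
  have hcV : col.transpose * V =
      ((∑ j ∈ Finset.range m, v j • T (m + j) : SymMat p) : Matrix (Fin p) (Fin p) ℝ) := by
    ext a b
    rw [Matrix.mul_apply, Fintype.sum_prod_type, Finset.sum_range]
    have hsym : ∀ i : ℕ, (T (m + i) : Matrix (Fin p) (Fin p) ℝ) b a =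
      (T (m + i) : Matrix (Fin p) (Fin p) ℝ) a b := fun i => (T (m + i)).2.apply a b
    simp [hV, hcol, hankelColumn, blockColumn, Matrix.one_apply, Matrix.sum_apply, hsym,
      add_comm, mul_comm]
  have key : (blockColumn D m).transpose * H⁻¹ * blockColumn D m =
      col.transpose * H⁻¹ * col + col.transpose * V + V.transpose * blockColumn D m := by
    nth_rw 1 [hDcol]
    rw [Matrix.transpose_add, Matrix.transpose_mul, hHs, Matrix.add_mul, Matrix.add_mul,
      Matrix.mul_assoc V.transpose, Matrix.mul_nonsing_inv _ hT, Matrix.mul_one]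
    congr 1
    rw [hDcol, Matrix.mul_add, ← Matrix.mul_assoc, Matrix.mul_assoc col.transpose H⁻¹ H,
      Matrix.nonsing_inv_mul _ hT, Matrix.mul_one]
  rw [key, hVD, hcV, hankelSchur, Finset.sum_range_succ, hv, one_smul, hD m,
    Finset.sum_range_succ, hv, one_smul, two_mul]
  push_cast
  abel

/-- The Schur complement of the block Hankel matrix of a linear functional `Λ`, weighted by `w`,
from a monic trial polynomial `q`. -/
theorem hankelSchur_functional {T : ℕ → SymMat p} {m e : ℕ} (hT : IsUnit (blockHankel T m).det)
    (Λ : ℝ[X] →ₗ[ℝ] SymMat p) (w : ℝ[X]) (hTΛ : ∀ i, T i = Λ (w * X ^ (2 * (i + e))))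
    {q : ℝ[X]} (he : e < 2) (hpar : ∀ x, q.eval (-x) = (-1) ^ (2 * m + e) * q.eval x)
    (hd : q.natDegree = 2 * m + e) (hc : q.coeff (2 * m + e) = 1) :
    hankelSchur T m = (Λ (w * q ^ 2) : Matrix (Fin p) (Fin p) ℝ) -
      (blockColumn (fun i => Λ (w * (X ^ (2 * i + e) * q))) m).transpose *
        (blockHankel T m)⁻¹ * blockColumn (fun i => Λ (w * (X ^ (2 * i + e) * q))) m := by
  have hq := eq_sum_of_parity he hpar hd
  have hD : ∀ i, Λ (w * (X ^ (2 * i + e) * q)) =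
      ∑ j ∈ Finset.range (m + 1), q.coeff (2 * j + e) • T (i + j) := by
    intro i
    conv_lhs => rw [hq]
    rw [Finset.mul_sum, Finset.mul_sum, map_sum]
    refine Finset.sum_congr rfl fun j _ => ?_
    rw [hTΛ, ← map_smul, smul_eq_C_mul]
    congr 1
    ring
  rw [hankelSchur_eq_sub hT (v := fun i => q.coeff (2 * i + e)) hc hD]
  congr 2
  conv_rhs => rw [sq]; enter [2, 2, 1]; rw [hq]
  rw [Finset.sum_mul, Finset.mul_sum, map_sum]
  refine Finset.sum_congr rfl fun j _ => ?_
  rw [← map_smul, smul_eq_C_mul]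
  congr 1
  ring

theorem lower_hankelSchur {s : ℕ → SymMat p} {m e : ℕ} (he : e < 2)
    (hT : IsUnit (blockHankel (fun i => s (i + e)) m).det) :
    hankelSchur (fun i => s (i + e)) m =
      (((((2 : ℝ) ^ (2 * m + e - 1))⁻¹ ^ 2 / 2) •
        (s 0 + evenFunctional s (Chebyshev.T ℝ (2 * (2 * m + e : ℕ)))) : SymMat p) : Matrix (Fin p) (Fin p) ℝ) -
      (blockColumn (fun i => evenFunctional s (X ^ (2 * i + e) * monicT (2 * m + e))) m).transpose *
        (blockHankel (fun i => s (i + e)) m)⁻¹ *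
        blockColumn (fun i => evenFunctional s (X ^ (2 * i + e) * monicT (2 * m + e))) m := by
  have h := hankelSchur_functional hT (evenFunctional s) 1
    (fun i => by rw [one_mul, evenFunctional_X_pow_two_mul]) he (monicT_eval_neg _)
    (natDegree_monicT _) (coeff_monicT _)
  simp only [one_mul] at h
  rw [h, monicT_sq, map_smul, map_add, ← evenFunctional_X_pow_two_mul s 0, mul_zero, pow_zero]

theorem upper_hankelSchur {s : ℕ → SymMat p} {m e : ℕ} (he : e < 2)
    (hT : IsUnit (blockHankel (fun i => s (i + e) - s (i + e + 1)) m).det) :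
    hankelSchur (fun i => s (i + e) - s (i + e + 1)) m =
      (((((2 : ℝ) ^ (2 * m + e))⁻¹ ^ 2 / 2) •
        (s 0 - evenFunctional s (Chebyshev.T ℝ (2 * (2 * m + e + 1 : ℕ)))) : SymMat p) : Matrix (Fin p) (Fin p) ℝ) -
      (blockColumn (fun i => evenFunctional s
          ((1 - X ^ 2) * (X ^ (2 * i + e) * monicU (2 * m + e)))) m).transpose *
        (blockHankel (fun i => s (i + e) - s (i + e + 1)) m)⁻¹ *
        blockColumn (fun i => evenFunctional s
          ((1 - X ^ 2) * (X ^ (2 * i + e) * monicU (2 * m + e)))) m := by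
  have h := hankelSchur_functional hT (evenFunctional s) (1 - X ^ 2)
    (fun i => by
      rw [sub_mul, one_mul, map_sub, ← pow_add, evenFunctional_X_pow_two_mul,
        show 2 + 2 * (i + e) = 2 * (i + e + 1) by ring, evenFunctional_X_pow_two_mul])
    he (monicU_eval_neg _) (natDegree_monicU _) (coeff_monicU _)
  rw [h, one_sub_X_sq_mul_monicU_sq, map_smul, map_sub, ← evenFunctional_X_pow_two_mul s 0,
    mul_zero, pow_zero]

end

/-! ### Exact distances to the bounds, and the arcsine law as preimage of the centre. -/

noncomputable section
variable {p : ℕ}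

open Polynomial

/-- The quadratic correction to the linearized distance of a moment from its lower bound. -/
def lowerDefect (s : ℕ → SymMat p) (m e : ℕ) : Matrix (Fin p) (Fin p) ℝ :=
  (blockColumn (fun i => evenFunctional s (X ^ (2 * i + e) * monicT (2 * m + e))) m).transpose *
    (blockHankel (fun i => s (i + e)) m)⁻¹ *
    blockColumn (fun i => evenFunctional s (X ^ (2 * i + e) * monicT (2 * m + e))) m

/-- The quadratic correction to the linearized distance of a moment from its upper bound. -/
def upperDefect (s : ℕ → SymMat p) (m e : ℕ) : Matrix (Fin p) (Fin p) ℝ :=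
  (blockColumn (fun i => evenFunctional s
      ((1 - X ^ 2) * (X ^ (2 * i + e) * monicU (2 * m + e)))) m).transpose *
    (blockHankel (fun i => s (i + e) - s (i + e + 1)) m)⁻¹ *
    blockColumn (fun i => evenFunctional s
      ((1 - X ^ 2) * (X ^ (2 * i + e) * monicU (2 * m + e)))) m

theorem HankelPosDef.lower {s : ℕ → SymMat p} {n m e : ℕ} (h : HankelPosDef s n) (he : e < 2)
    (hn : 2 * m + e ≤ n + 1) : (blockHankel (fun i => s (i + e)) m).PosDef := by
  rcases m with _ | m
  · exact blockHankel_zero_posDef _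
  · obtain rfl | rfl : e = 0 ∨ e = 1 := by omega
    · exact h.lower_even m (by omega)
    · exact h.lower_odd m (by omega)

theorem HankelPosDef.upper {s : ℕ → SymMat p} {n m e : ℕ} (h : HankelPosDef s n) (he : e < 2)
    (hn : 2 * m + e ≤ n) : (blockHankel (fun i => s (i + e) - s (i + e + 1)) m).PosDef := by
  rcases m with _ | m
  · exact blockHankel_zero_posDef _
  · obtain rfl | rfl : e = 0 ∨ e = 1 := by omega
    · exact h.upper_odd m (by omega)
    · exact h.upper_even m (by omega)

/-- The linearized half range of the `n`-th moment. -/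
def halfRange (n : ℕ) : ℝ := ((2 : ℝ) ^ (n - 1))⁻¹ ^ 2 / 2

theorem halfRange_pos (n : ℕ) : 0 < halfRange n := by
  rw [halfRange]
  positivity

theorem Matrix.PosDef.isUnit_det {n : Type*} [Fintype n] [DecidableEq n] {A : Matrix n n ℝ}
    (hA : A.PosDef) : IsUnit A.det := (Matrix.isUnit_iff_isUnit_det _).1 hA.isUnit

theorem sub_momentLower_eq {s : ℕ → SymMat p} (hs : (s 0 : Matrix (Fin p) (Fin p) ℝ) = 1)
    {m e : ℕ} (he : e < 2) (hj : 1 ≤ 2 * m + e) (h : HankelPosDef s (2 * m + e - 1)) :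
    (s (2 * m + e) : Matrix (Fin p) (Fin p) ℝ) - momentLower s (2 * m + e) =
      halfRange (2 * m + e) • (1 + (evenFunctional s (Chebyshev.T ℝ (2 * (2 * m + e : ℕ))) :
        Matrix (Fin p) (Fin p) ℝ)) - lowerDefect s m e := by
  have hu := (h.lower (m := m) he (by omega)).isUnit_det
  have key := lower_hankelSchur he hu
  rw [Submodule.coe_smul, Submodule.coe_add, hs] at key
  rw [halfRange, lowerDefect, ← key]
  obtain rfl | rfl : e = 0 ∨ e = 1 := by omega
  · obtain ⟨m, rfl⟩ : ∃ m', m = m' + 1 := ⟨m - 1, by omega⟩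
    exact sub_momentLower_even s m
  · exact sub_momentLower_odd s m

theorem momentUpper_sub_eq {s : ℕ → SymMat p} (hs : (s 0 : Matrix (Fin p) (Fin p) ℝ) = 1)
    {m e : ℕ} (he : e < 2) (h : HankelPosDef s (2 * m + e)) :
    momentUpper s (2 * m + e + 1) - (s (2 * m + e + 1) : Matrix (Fin p) (Fin p) ℝ) =
      halfRange (2 * m + e + 1) •
        (1 - (evenFunctional s (Chebyshev.T ℝ (2 * (2 * m + e + 1 : ℕ))) :
          Matrix (Fin p) (Fin p) ℝ)) - upperDefect s m e := by
  have hu := (h.upper (m := m) he le_rfl).isUnit_det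
  have key := upper_hankelSchur he hu
  rw [Submodule.coe_smul, Submodule.coe_sub, hs] at key
  rw [halfRange, upperDefect, Nat.add_sub_cancel, ← key]
  obtain rfl | rfl : e = 0 ∨ e = 1 := by omega
  · exact momentUpper_sub_odd s hs m
  · exact momentUpper_sub_even s m

/-- The moments of the arcsine distribution on `[0, 1]`, as scalar matrices. -/
def arcsineSeq (p : ℕ) (i : ℕ) : SymMat p := arcsineMoment i • ⟨1, Matrix.isSymm_one⟩

theorem arcsineSeq_zero (p : ℕ) : (arcsineSeq p 0 : Matrix (Fin p) (Fin p) ℝ) = 1 := by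
  rw [arcsineSeq, arcsineMoment_zero, one_smul]

theorem evenFunctional_arcsineSeq (q : ℝ[X]) :
    evenFunctional (arcsineSeq p) q = arcsineFunctional q • ⟨1, Matrix.isSymm_one⟩ :=
  evenFunctional_arcsineMoment _ q

theorem evenFunctional_arcsineSeq_T {n : ℤ} (hn : n ≠ 0) :
    evenFunctional (arcsineSeq p) (Chebyshev.T ℝ n) = 0 := by
  rw [evenFunctional_arcsineSeq, arcsineFunctional_T hn, zero_smul]

theorem evenFunctional_arcsineSeq_monicT {i m e : ℕ} (hi : i < m) :
    evenFunctional (arcsineSeq p) (X ^ (2 * i + e) * monicT (2 * m + e)) = 0 := by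
  rw [evenFunctional_arcsineSeq, arcsineFunctional_X_pow_mul_monicT (by omega), zero_smul]

theorem evenFunctional_arcsineSeq_monicU {i m e : ℕ} (hi : i < m) :
    evenFunctional (arcsineSeq p) ((1 - X ^ 2) * (X ^ (2 * i + e) * monicU (2 * m + e))) = 0 := by
  rw [evenFunctional_arcsineSeq, arcsineFunctional_X_pow_mul_monicU (by omega), zero_smul]

theorem lowerDefect_arcsineSeq (m e : ℕ) : lowerDefect (arcsineSeq p) m e = 0 := by
  have : blockColumn (fun i => evenFunctional (arcsineSeq p)
      (X ^ (2 * i + e) * monicT (2 * m + e))) m = 0 := by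
    ext x b
    simp [blockColumn, evenFunctional_arcsineSeq_monicT x.1.2]
  rw [lowerDefect, this, Matrix.mul_zero]

theorem upperDefect_arcsineSeq (m e : ℕ) : upperDefect (arcsineSeq p) m e = 0 := by
  have : blockColumn (fun i => evenFunctional (arcsineSeq p)
      ((1 - X ^ 2) * (X ^ (2 * i + e) * monicU (2 * m + e)))) m = 0 := by
    ext x b
    rw [blockColumn, Matrix.of_apply, evenFunctional_arcsineSeq_monicU x.1.2]
    rfl
  rw [upperDefect, this, Matrix.mul_zero]

/-- Orthogonality makes the trial polynomial optimal, so the defect and the Chebyshev moment both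
vanish. -/
theorem arcsineSeq_sub_momentLower {n : ℕ} (h : HankelPosDef (arcsineSeq p) n) :
    (arcsineSeq p (n + 1) : Matrix (Fin p) (Fin p) ℝ) - momentLower (arcsineSeq p) (n + 1) =
      halfRange (n + 1) • (1 : Matrix (Fin p) (Fin p) ℝ) := by
  obtain ⟨m, e, he, hn⟩ : ∃ m e, e < 2 ∧ n + 1 = 2 * m + e :=
    ⟨(n + 1) / 2, (n + 1) % 2, by omega, by omega⟩
  rw [hn, sub_momentLower_eq (arcsineSeq_zero p) he (by omega)
    (by rwa [← hn, Nat.add_sub_cancel]), lowerDefect_arcsineSeq,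
    evenFunctional_arcsineSeq_T (by omega)]
  simp

theorem momentUpper_sub_arcsineSeq {n : ℕ} (h : HankelPosDef (arcsineSeq p) n) :
    momentUpper (arcsineSeq p) (n + 1) - (arcsineSeq p (n + 1) : Matrix (Fin p) (Fin p) ℝ) =
      halfRange (n + 1) • (1 : Matrix (Fin p) (Fin p) ℝ) := by
  obtain ⟨m, e, he, rfl⟩ : ∃ m e, e < 2 ∧ n = 2 * m + e :=
    ⟨n / 2, n % 2, by omega, by omega⟩
  rw [momentUpper_sub_eq (arcsineSeq_zero p) he h, upperDefect_arcsineSeq,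
    evenFunctional_arcsineSeq_T (by omega)]
  simp

/-- Definiteness up to `n` licenses the distance formulas at `n + 1`, which are positive scalars;
hence induction. -/
theorem strictlyBetween_arcsineSeq (n : ℕ) : StrictlyBetween (arcsineSeq p) n := by
  induction n with
  | zero => exact fun j h1 h2 => by omega
  | succ n ih =>
    intro j h1 h2
    rcases Nat.lt_or_eq_of_le h2 with h3 | rfl
    · exact ih j h1 (by omega)
    · have h := (strictlyBetween_iff_hankelPosDef (arcsineSeq_zero p) n).1 ih
      rw [arcsineSeq_sub_momentLower h, momentUpper_sub_arcsineSeq h]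
      exact ⟨Matrix.PosDef.one.smul (halfRange_pos _), Matrix.PosDef.one.smul (halfRange_pos _)⟩

theorem hankelPosDef_arcsineSeq (n : ℕ) : HankelPosDef (arcsineSeq p) n :=
  (strictlyBetween_iff_hankelPosDef (arcsineSeq_zero p) n).1 (strictlyBetween_arcsineSeq n)

theorem canonicalMoment_arcsineSeq (n : ℕ) :
    canonicalMoment (arcsineSeq p) (n + 1) = (1 / 2 : ℝ) • (1 : Matrix (Fin p) (Fin p) ℝ) := by
  have hR := (strictlyBetween_arcsineSeq (p := p) n).range_posDef (arcsineSeq_zero p)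
  -- For a scalar `U` the square roots recombine to the range; what remains is that the moment is
  -- the midpoint of its bounds.
  rw [canonicalMoment_eq_iff hR, mul_smul_comm, mul_one, smul_mul_assoc, hR.sqrt_mul_sqrt]
  have h1 := arcsineSeq_sub_momentLower (hankelPosDef_arcsineSeq (p := p) n)
  have h2 := momentUpper_sub_arcsineSeq (hankelPosDef_arcsineSeq (p := p) n)
  rw [show momentUpper (arcsineSeq p) (n + 1) - momentLower (arcsineSeq p) (n + 1) =
    (momentUpper (arcsineSeq p) (n + 1) - (arcsineSeq p (n + 1) : Matrix (Fin p) (Fin p) ℝ)) +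
    ((arcsineSeq p (n + 1) : Matrix (Fin p) (Fin p) ℝ) - momentLower (arcsineSeq p) (n + 1)) by
    abel, h1, h2, ← sub_eq_iff_eq_add', h1]
  module

/-- The preimage of the centre of the cube consists of the moments of the arcsine
distribution. -/
theorem invCanonicalMoments_cubeCenter (p k : ℕ) :
    invCanonicalMoments p k (cubeCenter p k) = fun j : Fin k => arcsineSeq p (j + 1) := by
  have hmem : (fun j : Fin k => arcsineSeq p (j + 1)) ∈ interior (momentSpace p k) := by
    rw [interior_momentSpace]
    exact (strictlyBetween_arcsineSeq k).congr fun i hi =>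
      (momentSeq_of_seq (arcsineSeq_zero p) hi).symm
  have himg : canonicalMoments (fun j : Fin k => arcsineSeq p (j + 1)) = cubeCenter p k := by
    funext j
    apply Subtype.ext
    rw [coe_canonicalMoments, canonicalMoment_congr
      fun i hi => momentSeq_of_seq (arcsineSeq_zero p) (hi.trans (Nat.succ_le_of_lt j.2)),
      canonicalMoment_arcsineSeq]
    rfl
  rw [invCanonicalMoments, ← himg]
  exact (bijOn_canonicalMoments p k).injOn.leftInvOn_invFunOn hmem

end

noncomputable section

open Asymptotics Filter Topology

/-! ### Entrywise asymptotics of matrices -/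

variable {α ι κ μ : Type*} {l : Filter α} {g h : α → ℝ}

/-- All entries of `F` are `O(g)`. -/
def EntrywiseBigO (l : Filter α) (F : α → Matrix ι κ ℝ) (g : α → ℝ) : Prop :=
  ∀ a b, (fun x => F x a b) =O[l] g

/-- All entries of `F` are `o(g)`. -/
def EntrywiseLittleO (l : Filter α) (F : α → Matrix ι κ ℝ) (g : α → ℝ) : Prop :=
  ∀ a b, (fun x => F x a b) =o[l] g

namespace EntrywiseLittleO

variable {F G : α → Matrix ι κ ℝ}

theorem bigO (hF : EntrywiseLittleO l F g) : EntrywiseBigO l F g := fun a b => (hF a b).isBigO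

theorem congr' (hF : EntrywiseLittleO l F g) (h : F =ᶠ[l] G) : EntrywiseLittleO l G g :=
  fun a b => (hF a b).congr' (h.mono fun x hx => by simp only [hx]) EventuallyEq.rfl

theorem add (hF : EntrywiseLittleO l F g) (hG : EntrywiseLittleO l G g) :
    EntrywiseLittleO l (fun x => F x + G x) g := fun a b => (hF a b).add (hG a b)

theorem const_smul (c : ℝ) (hF : EntrywiseLittleO l F g) :
    EntrywiseLittleO l (fun x => c • F x) g := fun a b => (hF a b).const_mul_left c

theorem sum {β : Type*} (s : Finset β) {F : β → α → Matrix ι κ ℝ}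
    (hF : ∀ i ∈ s, EntrywiseLittleO l (F i) g) :
    EntrywiseLittleO l (fun x => ∑ i ∈ s, F i x) g := fun a b => by
  simp only [Matrix.sum_apply]
  exact IsLittleO.fun_sum fun i hi => hF i hi a b

theorem mul_bigO [Fintype κ] {G : α → Matrix κ μ ℝ} (hF : EntrywiseLittleO l F g)
    (hG : EntrywiseBigO l G fun _ => (1 : ℝ)) : EntrywiseLittleO l (fun x => F x * G x) g :=
  fun a b => by
    simp only [Matrix.mul_apply]
    exact IsLittleO.fun_sum fun i _ => by simpa using (hF a i).mul_isBigO (hG i b)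

end EntrywiseLittleO

namespace EntrywiseBigO

variable {F G : α → Matrix ι κ ℝ}

theorem congr' (hF : EntrywiseBigO l F g) (h : F =ᶠ[l] G) : EntrywiseBigO l G g :=
  fun a b => (hF a b).congr' (h.mono fun x hx => by simp only [hx]) EventuallyEq.rfl

theorem add (hF : EntrywiseBigO l F g) (hG : EntrywiseBigO l G g) :
    EntrywiseBigO l (fun x => F x + G x) g := fun a b => (hF a b).add (hG a b)

theorem const_smul (c : ℝ) (hF : EntrywiseBigO l F g) :
    EntrywiseBigO l (fun x => c • F x) g := fun a b => (hF a b).const_mul_left c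

theorem sum {β : Type*} (s : Finset β) {F : β → α → Matrix ι κ ℝ}
    (hF : ∀ i ∈ s, EntrywiseBigO l (F i) g) :
    EntrywiseBigO l (fun x => ∑ i ∈ s, F i x) g := fun a b => by
  simp only [Matrix.sum_apply]
  exact IsBigO.fun_sum fun i hi => hF i hi a b

theorem mul [Fintype κ] {G : α → Matrix κ μ ℝ} (hF : EntrywiseBigO l F g) (hG : EntrywiseBigO l G h) :
    EntrywiseBigO l (fun x => F x * G x) fun x => g x * h x := fun a b => by
  simp only [Matrix.mul_apply]
  exact IsBigO.fun_sum fun i _ => (hF a i).mul (hG i b)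

theorem transpose (hF : EntrywiseBigO l F g) : EntrywiseBigO l (fun x => (F x).transpose) g :=
  fun a b => hF b a

theorem mul_littleO [Fintype κ] {G : α → Matrix κ μ ℝ} (hF : EntrywiseBigO l F fun _ => (1 : ℝ))
    (hG : EntrywiseLittleO l G g) : EntrywiseLittleO l (fun x => F x * G x) g := fun a b => by
  simp only [Matrix.mul_apply]
  exact IsLittleO.fun_sum fun i _ => by simpa using (hF a i).mul_isLittleO (hG i b)

theorem of_tendsto {A : Matrix ι κ ℝ} (hF : Tendsto F l (𝓝 A)) :
    EntrywiseBigO l F fun _ => (1 : ℝ) := fun a b =>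
  (((continuous_id.matrix_elem a b).tendsto A).comp hF).isBigO_one ℝ

theorem tendsto_of_tendsto_zero {A : Matrix ι κ ℝ} (hF : EntrywiseBigO l (fun x => F x - A) g)
    (hg : Tendsto g l (𝓝 0)) : Tendsto F l (𝓝 A) := by
  refine tendsto_pi_nhds.2 fun a => tendsto_pi_nhds.2 fun b => ?_
  have := ((hF a b).trans_tendsto hg).add_const (A a b)
  simpa using this

end EntrywiseBigO

theorem Matrix.tendsto_inv {n : Type*} [Fintype n] [DecidableEq n] {F : α → Matrix n n ℝ}
    {A : Matrix n n ℝ} (hA : IsUnit A.det) (hF : Tendsto F l (𝓝 A)) :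
    Tendsto (fun x => (F x)⁻¹) l (𝓝 A⁻¹) := by
  simp only [Matrix.inv_def, Ring.inverse_eq_inv']
  have hdet : Tendsto (fun x => (F x).det) l (𝓝 A.det) :=
    ((continuous_id.matrix_det).tendsto A).comp hF
  have hadj : Tendsto (fun x => (F x).adjugate) l (𝓝 A.adjugate) :=
    ((continuous_id.matrix_adjugate).tendsto A).comp hF
  exact (hdet.inv₀ hA.ne_zero).smul hadj

theorem frobNorm_eq {ι κ : Type} [Fintype ι] [Fintype κ] (Y : Matrix ι κ ℝ) :
    frobNorm Y = √(∑ i, ∑ j, Y i j ^ 2) := by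
  rw [frobNorm, Finset.sum_comm]
  congr 1
  simp [Matrix.trace, Matrix.mul_apply, sq]

theorem frobNorm_nonneg {ι κ : Type} [Fintype ι] [Fintype κ] (Y : Matrix ι κ ℝ) :
    0 ≤ frobNorm Y := Real.sqrt_nonneg _

theorem abs_le_frobNorm {ι κ : Type} [Fintype ι] [Fintype κ] (Y : Matrix ι κ ℝ) (i : ι) (j : κ) :
    |Y i j| ≤ frobNorm Y := by
  rw [frobNorm_eq, ← Real.sqrt_sq_eq_abs]
  refine Real.sqrt_le_sqrt ?_
  refine le_trans ?_ (Finset.single_le_sum (f := fun i => ∑ j, Y i j ^ 2)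
    (fun i _ => Finset.sum_nonneg fun j _ => sq_nonneg _) (Finset.mem_univ i))
  exact Finset.single_le_sum (f := fun j => Y i j ^ 2) (fun j _ => sq_nonneg _)
    (Finset.mem_univ j)

theorem frobNorm_le_sum {ι κ : Type} [Fintype ι] [Fintype κ] (Y : Matrix ι κ ℝ) :
    frobNorm Y ≤ ∑ i, ∑ j, |Y i j| := by
  rw [frobNorm_eq]
  refine Real.sqrt_le_iff.2 ⟨Finset.sum_nonneg fun i _ => Finset.sum_nonneg fun j _ =>
    abs_nonneg _, ?_⟩
  rw [← Fintype.sum_prod_type', ← Fintype.sum_prod_type']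
  simp only [← sq_abs (Y _ _)]
  exact Finset.sum_sq_le_sq_sum_of_nonneg fun i _ => abs_nonneg _

theorem EntrywiseLittleO.frobNorm {ι κ : Type} [Fintype ι] [Fintype κ] {F : α → Matrix ι κ ℝ}
    (hF : EntrywiseLittleO l F g) : (fun x => frobNorm (F x)) =o[l] g := by
  have h : (fun x => ∑ i, ∑ j, |F x i j|) =o[l] g :=
    IsLittleO.fun_sum fun i _ => IsLittleO.fun_sum fun j _ => (hF i j).abs_left
  refine IsBigO.trans_isLittleO (IsBigO.of_bound 1 (Eventually.of_forall fun x => ?_)) h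
  rw [one_mul, Real.norm_of_nonneg (frobNorm_nonneg _)]
  exact (frobNorm_le_sum _).trans (le_abs_self _)

/-- The square root is Lipschitz at positive scalar matrices. -/
theorem frobNorm_sqrt_sub_le {p : ℕ} {R : Matrix (Fin p) (Fin p) ℝ} (hR : R.PosDef) {r : ℝ}
    (hr : 0 < r) :
    frobNorm (CFC.sqrt R - r • (1 : Matrix (Fin p) (Fin p) ℝ)) ≤
      r⁻¹ * frobNorm (R - (r ^ 2) • (1 : Matrix (Fin p) (Fin p) ℝ)) := by
  set Q := CFC.sqrt R with hQ
  have hQp : Q.PosSemidef := Matrix.nonneg_iff_posSemidef.1 (CFC.sqrt_nonneg R)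
  have hQs : Q.transpose = Q := Matrix.sqrt_isSymm R
  set Y := Q - r • (1 : Matrix (Fin p) (Fin p) ℝ) with hY
  have hYs : Y.transpose = Y := by
    rw [hY, Matrix.transpose_sub, hQs, Matrix.transpose_smul, Matrix.transpose_one]
  have hRY : R - (r ^ 2) • (1 : Matrix (Fin p) (Fin p) ℝ) =
      (Q + r • (1 : Matrix (Fin p) (Fin p) ℝ)) * Y := by
    rw [← hR.sqrt_mul_sqrt, hY, ← hQ]
    simp only [Matrix.add_mul, Matrix.mul_sub, Matrix.smul_mul, Matrix.mul_smul, Matrix.one_mul,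
      Matrix.mul_one]
    module
  have hP : (Q * Q + (2 * r) • Q).PosSemidef := by
    refine Matrix.PosSemidef.add ?_ (hQp.smul (by positivity))
    have := Matrix.posSemidef_conjTranspose_mul_self Q
    rwa [Matrix.conjTranspose_eq_transpose_of_trivial, hQs] at this
  -- From `R - r² = (Q + r) Y` and `(Q + r)² = (Q² + 2 r Q) + r²`, where the bracket is
  -- semidefinite; hence `‖R - r²‖ ≥ r ‖Y‖`.
  have hT : ((R - (r ^ 2) • (1 : Matrix (Fin p) (Fin p) ℝ)).transpose *
      (R - (r ^ 2) • (1 : Matrix (Fin p) (Fin p) ℝ))).trace =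
      (Y.transpose * (Q * Q + (2 * r) • Q) * Y).trace + r ^ 2 * (Y.transpose * Y).trace := by
    rw [hRY, ← smul_eq_mul (r ^ 2), ← Matrix.trace_smul, ← Matrix.trace_add]
    congr 1
    rw [Matrix.transpose_mul, Matrix.transpose_add, hQs, Matrix.transpose_smul,
      Matrix.transpose_one]
    simp only [Matrix.add_mul, Matrix.mul_add, Matrix.smul_mul, Matrix.mul_smul, Matrix.one_mul,
      Matrix.mul_one, Matrix.mul_assoc]
    module
  have hnn : 0 ≤ (Y.transpose * (Q * Q + (2 * r) • Q) * Y).trace := by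
    have := (hP.conjTranspose_mul_mul_same Y).trace_nonneg
    rwa [Matrix.conjTranspose_eq_transpose_of_trivial] at this
  rw [inv_mul_eq_div, le_div_iff₀ hr, frobNorm, frobNorm, hT, mul_comm]
  nth_rw 1 [← Real.sqrt_sq hr.le]
  rw [← Real.sqrt_mul (sq_nonneg r)]
  exact Real.sqrt_le_sqrt (by linarith)

theorem EntrywiseLittleO.sqrt_sub {p : ℕ} {R : α → Matrix (Fin p) (Fin p) ℝ} {r : ℝ} (hr : 0 < r)
    (hR : ∀ᶠ x in l, (R x).PosDef)
    (h : EntrywiseLittleO l (fun x => R x - (r ^ 2) • (1 : Matrix (Fin p) (Fin p) ℝ)) g) :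
    EntrywiseLittleO l (fun x => CFC.sqrt (R x) - r • (1 : Matrix (Fin p) (Fin p) ℝ)) g := by
  intro a b
  refine IsBigO.trans_isLittleO (IsBigO.of_bound r⁻¹ ?_) h.frobNorm
  filter_upwards [hR] with x hx
  rw [Real.norm_of_nonneg (frobNorm_nonneg _), Real.norm_eq_abs]
  exact (abs_le_frobNorm _ a b).trans (frobNorm_sqrt_sub_le hx hr)

end

/-! ### First order expansion of the Chebyshev moments at the arcsine law. -/

noncomputable section

open Asymptotics Filter Topology Polynomial

section

variable {p : ℕ} {α : Type*} {l : Filter α} {g : α → ℝ} {S : α → ℕ → SymMat p} {n : ℕ}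

/-- The inverses converge, hence stay bounded, and the expression is `O(g²)`. -/
theorem EntrywiseBigO.quadratic_littleO {ι κ : Type*} [Fintype ι] [DecidableEq ι]
    {D : α → Matrix ι κ ℝ} {H : α → Matrix ι ι ℝ} {H₀ : Matrix ι ι ℝ}
    (hg : Tendsto g l (𝓝 0)) (hD : EntrywiseBigO l D g) (hH : Tendsto H l (𝓝 H₀))
    (hH₀ : IsUnit H₀.det) :
    EntrywiseLittleO l (fun x => (D x).transpose * (H x)⁻¹ * D x) g := fun a b => by
  have h := ((hD.transpose.mul (EntrywiseBigO.of_tendsto (Matrix.tendsto_inv hH₀ hH))).mul hD) a b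
  refine h.trans_isLittleO ?_
  simpa using ((isLittleO_one_iff ℝ).2 hg).mul_isBigO (isBigO_refl g l)

/-- Degree `2n + 1` is allowed: odd powers are sent to `0`, so only `s_0, …, s_n` enter, and the
value is linear in their deviations. -/
theorem entrywiseBigO_evenFunctional
    (hS : ∀ i ≤ n, EntrywiseBigO l (fun x =>
      (S x i : Matrix (Fin p) (Fin p) ℝ) - (arcsineSeq p i : Matrix (Fin p) (Fin p) ℝ)) g)
    {q : ℝ[X]} (hq : q.natDegree < 2 * n + 2) (h0 : evenFunctional (arcsineSeq p) q = 0) :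
    EntrywiseBigO l (fun x => (evenFunctional (S x) q : Matrix (Fin p) (Fin p) ℝ)) g := by
  have h : ∀ x, (evenFunctional (S x) q : Matrix (Fin p) (Fin p) ℝ) =
      ∑ i ∈ Finset.range (2 * n + 2), q.coeff i • if Even i then
        (S x (i / 2) : Matrix (Fin p) (Fin p) ℝ) -
          (arcsineSeq p (i / 2) : Matrix (Fin p) (Fin p) ℝ) else 0 := by
    intro x
    rw [← sub_zero (evenFunctional (S x) q), ← h0, ← evenFunctional_sub,
      evenFunctional_eq_sum _ hq, Submodule.coe_sum]
    refine Finset.sum_congr rfl fun i _ => ?_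
    split_ifs <;> simp
  simp only [h]
  refine EntrywiseBigO.sum _ fun i hi => ?_
  rw [Finset.mem_range] at hi
  by_cases hi' : Even i
  · simpa only [hi', if_true] using (hS (i / 2) (by omega)).const_smul (q.coeff i)
  · simp only [hi', if_false, smul_zero]
    exact fun a b => isBigO_zero _ _

theorem tendsto_blockHankel {T : α → ℕ → SymMat p} {T₀ : ℕ → SymMat p} {m : ℕ}
    (h : ∀ i, i + 2 ≤ 2 * m → Tendsto (fun x => (T x i : Matrix (Fin p) (Fin p) ℝ)) l
      (𝓝 (T₀ i : Matrix (Fin p) (Fin p) ℝ))) :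
    Tendsto (fun x => blockHankel (T x) m) l (𝓝 (blockHankel T₀ m)) := by
  refine tendsto_pi_nhds.2 fun a => tendsto_pi_nhds.2 fun b => ?_
  exact ((continuous_id.matrix_elem a.2 b.2).tendsto _).comp (h (a.1 + b.1) (by omega))

theorem lowerDefect_littleO (hg : Tendsto g l (𝓝 0))
    (hS : ∀ i ≤ n, EntrywiseBigO l (fun x =>
      (S x i : Matrix (Fin p) (Fin p) ℝ) - (arcsineSeq p i : Matrix (Fin p) (Fin p) ℝ)) g)
    {m e : ℕ} (he : e < 2) (hn : n + 1 = 2 * m + e) :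
    EntrywiseLittleO l (fun x => lowerDefect (S x) m e) g := by
  refine EntrywiseBigO.quadratic_littleO hg (fun a b => ?_)
    (tendsto_blockHankel (T₀ := fun i => arcsineSeq p (i + e)) fun i hi =>
      (hS (i + e) (by omega)).tendsto_of_tendsto_zero hg)
    ((hankelPosDef_arcsineSeq n).lower he (by omega)).isUnit_det
  refine entrywiseBigO_evenFunctional hS ?_ (evenFunctional_arcsineSeq_monicT a.1.2) a.2 b
  refine lt_of_le_of_lt natDegree_mul_le ?_
  rw [natDegree_X_pow, natDegree_monicT]
  omega

theorem upperDefect_littleO (hg : Tendsto g l (𝓝 0))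
    (hS : ∀ i ≤ n, EntrywiseBigO l (fun x =>
      (S x i : Matrix (Fin p) (Fin p) ℝ) - (arcsineSeq p i : Matrix (Fin p) (Fin p) ℝ)) g)
    {m e : ℕ} (he : e < 2) (hn : n = 2 * m + e) :
    EntrywiseLittleO l (fun x => upperDefect (S x) m e) g := by
  refine EntrywiseBigO.quadratic_littleO hg (fun a b => ?_)
    (tendsto_blockHankel (T₀ := fun i => arcsineSeq p (i + e) - arcsineSeq p (i + e + 1))
      fun i hi => ?_)
    ((hankelPosDef_arcsineSeq n).upper he (by omega)).isUnit_det
  · refine entrywiseBigO_evenFunctional hS ?_ (evenFunctional_arcsineSeq_monicU a.1.2) a.2 b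
    refine lt_of_le_of_lt natDegree_mul_le ?_
    have h1 : ((1 : ℝ[X]) - X ^ 2).natDegree ≤ 2 := by
      refine (natDegree_sub_le _ _).trans ?_
      simp
    have h2 := natDegree_mul_le (p := (X : ℝ[X]) ^ (2 * (a.1 : ℕ) + e)) (q := monicU (2 * m + e))
    rw [natDegree_X_pow, natDegree_monicU] at h2
    omega
  · exact ((hS (i + e) (by omega)).tendsto_of_tendsto_zero hg).sub
      ((hS (i + e + 1) (by omega)).tendsto_of_tendsto_zero hg)

/-- First order expansion of the `n + 1`-st Chebyshev moment in terms of the canonical moment. -/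
theorem evenFunctional_T_sub_littleO (hg : Tendsto g l (𝓝 0))
    (hS0 : ∀ x, (S x 0 : Matrix (Fin p) (Fin p) ℝ) = 1)
    (hS : ∀ i ≤ n, EntrywiseBigO l (fun x =>
      (S x i : Matrix (Fin p) (Fin p) ℝ) - (arcsineSeq p i : Matrix (Fin p) (Fin p) ℝ)) g)
    (hpos : ∀ᶠ x in l, HankelPosDef (S x) n)
    {W : α → Matrix (Fin p) (Fin p) ℝ} (hW : EntrywiseBigO l W g)
    (hcan : ∀ᶠ x in l, canonicalMoment (S x) (n + 1) =
      (1 / 2 : ℝ) • (1 : Matrix (Fin p) (Fin p) ℝ) + W x) :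
    EntrywiseLittleO l (fun x => (evenFunctional (S x) (Chebyshev.T ℝ (2 * (n + 1 : ℕ))) :
      Matrix (Fin p) (Fin p) ℝ) - (2 : ℝ) • W x) g := by
  obtain ⟨m, e, he, hn⟩ : ∃ m e, e < 2 ∧ n + 1 = 2 * m + e :=
    ⟨(n + 1) / 2, (n + 1) % 2, by omega, by omega⟩
  obtain ⟨m', e', he', hn'⟩ : ∃ m e, e < 2 ∧ n = 2 * m + e :=
    ⟨n / 2, n % 2, by omega, by omega⟩
  have hE := lowerDefect_littleO hg hS he hn
  have hE' := upperDefect_littleO hg hS he' hn'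
  -- The range tends to `2c`, so its square root tends to `r = √(2c)`.
  set c := halfRange (n + 1) with hc
  have hc0 : 0 < c := halfRange_pos _
  set r := √(2 * c) with hr
  have hr0 : 0 < r := Real.sqrt_pos.2 (by positivity)
  have hr2 : r ^ 2 = 2 * c := Real.sq_sqrt (by positivity)
  have hA : ∀ᶠ x in l, (S x (n + 1) : Matrix (Fin p) (Fin p) ℝ) - momentLower (S x) (n + 1) =
      c • (1 + (evenFunctional (S x) (Chebyshev.T ℝ (2 * (n + 1 : ℕ))) :
        Matrix (Fin p) (Fin p) ℝ)) - lowerDefect (S x) m e := by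
    filter_upwards [hpos] with x hx
    have key := sub_momentLower_eq (hS0 x) he (by omega)
      (show HankelPosDef (S x) (2 * m + e - 1) by rwa [← hn, Nat.add_sub_cancel])
    rwa [← hn] at key
  have hB : ∀ᶠ x in l, momentUpper (S x) (n + 1) - (S x (n + 1) : Matrix (Fin p) (Fin p) ℝ) =
      c • (1 - (evenFunctional (S x) (Chebyshev.T ℝ (2 * (n + 1 : ℕ))) :
        Matrix (Fin p) (Fin p) ℝ)) - upperDefect (S x) m' e' := by
    filter_upwards [hpos] with x hx
    have key := momentUpper_sub_eq (hS0 x) he' (show HankelPosDef (S x) (2 * m' + e') by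
      rwa [← hn'])
    rwa [← hn'] at key
  set R : α → Matrix (Fin p) (Fin p) ℝ := fun x =>
    momentUpper (S x) (n + 1) - momentLower (S x) (n + 1) with hR
  have hRpos : ∀ᶠ x in l, (R x).PosDef := by
    filter_upwards [hpos] with x hx
    exact ((strictlyBetween_iff_hankelPosDef (hS0 x) n).2 hx).range_posDef (hS0 x)
  -- The Chebyshev moment cancels in the sum of the two distances; only the two quadratic defects
  -- remain.
  have hRr : EntrywiseLittleO l
      (fun x => R x - (r ^ 2) • (1 : Matrix (Fin p) (Fin p) ℝ)) g := by
    refine ((hE.add hE').const_smul (-1)).congr' ?_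
    filter_upwards [hA, hB] with x h1 h2
    have h3 : R x = (momentUpper (S x) (n + 1) - (S x (n + 1) : Matrix (Fin p) (Fin p) ℝ)) +
        ((S x (n + 1) : Matrix (Fin p) (Fin p) ℝ) - momentLower (S x) (n + 1)) := by
      simp only [hR]
      abel
    rw [h3, h1, h2, hr2]
    module
  have hX := EntrywiseLittleO.sqrt_sub hr0 hRpos hRr
  set Q : α → Matrix (Fin p) (Fin p) ℝ := fun x => CFC.sqrt (R x) with hQ
  have hQ1 : EntrywiseBigO l Q fun _ => (1 : ℝ) :=
    EntrywiseBigO.of_tendsto (hX.bigO.tendsto_of_tendsto_zero hg)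
  have hU1 : EntrywiseBigO l (fun x => (1 / 2 : ℝ) • (1 : Matrix (Fin p) (Fin p) ℝ) + W x)
      fun _ => (1 : ℝ) := fun a b =>
    (isBigO_const_const _ one_ne_zero _).add
      (((hW a b).trans_tendsto hg).isBigO_one ℝ)
  -- With `U = 1/2 + W`, the sum is `(Q - r) U Q + r U (Q - r) + E = Q U Q - r² U + E`. Since `Q U Q
  -- = c (1 + Θ) - E` and `r² = 2c`, it equals `c (Θ - 2 W)`.
  have hmain := (((hX.mul_bigO hU1).mul_bigO hQ1).add
    ((hU1.mul_littleO hX).const_smul r)).add hE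
  refine (hmain.const_smul c⁻¹).congr' ?_
  filter_upwards [hA, hcan, hRpos] with x h1 h2 h3
  have h4 := sqrt_mul_canonicalMoment_mul_sqrt h3
  rw [h2, h1] at h4
  change Q x * _ * Q x = _ at h4
  have h5 : (Q x - r • (1 : Matrix (Fin p) (Fin p) ℝ)) *
      ((1 / 2 : ℝ) • (1 : Matrix (Fin p) (Fin p) ℝ) + W x) * Q x +
      r • (((1 / 2 : ℝ) • (1 : Matrix (Fin p) (Fin p) ℝ) + W x) *
        (Q x - r • (1 : Matrix (Fin p) (Fin p) ℝ))) =
      Q x * ((1 / 2 : ℝ) • (1 : Matrix (Fin p) (Fin p) ℝ) + W x) * Q x -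
        (r ^ 2) • ((1 / 2 : ℝ) • (1 : Matrix (Fin p) (Fin p) ℝ) + W x) := by
    simp only [Matrix.sub_mul, Matrix.mul_sub, Matrix.smul_mul, Matrix.mul_smul, Matrix.one_mul,
      Matrix.mul_one]
    module
  rw [h5, h4, hr2, eq_comm, ← sub_eq_zero]
  have hc1 := hc0.ne'
  match_scalars <;> field_simp <;> ring

end

end

/-! ### From Chebyshev moments back to moments: the matrix derivative. -/

noncomputable section

open Asymptotics Filter Topology Polynomial

/-- Folding at the middle term: the indices `l` and `2i - l` have equal binomial coefficients and
opposite arguments. -/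
theorem Finset.sum_range_choose_mul_even {V : Type*} [AddCommGroup V] [Module ℝ V] {f : ℤ → V}
    (hf : ∀ n, f (-n) = f n) (i : ℕ) :
    ∑ l ∈ Finset.range (2 * i + 1), ((2 * i).choose l : ℝ) • f (2 * i - 2 * l) =
      ((2 * i).choose i : ℝ) • f 0 +
        ∑ j ∈ Finset.range i, (2 * (2 * i).choose (i - 1 - j) : ℝ) • f (2 * (j + 1 : ℕ)) := by
  have h1 : ∑ l ∈ Finset.range i, ((2 * i).choose l : ℝ) • f (2 * i - 2 * l) =
      ∑ j ∈ Finset.range i, ((2 * i).choose (i - 1 - j) : ℝ) • f (2 * (j + 1 : ℕ)) := by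
    rw [← Finset.sum_range_reflect]
    refine Finset.sum_congr rfl fun j hj => ?_
    rw [Finset.mem_range] at hj
    congr 2
    omega
  have h2 : ∑ l ∈ Finset.range i, ((2 * i).choose (i + 1 + l) : ℝ) •
      f (2 * i - 2 * (i + 1 + l : ℕ)) =
      ∑ j ∈ Finset.range i, ((2 * i).choose (i - 1 - j) : ℝ) • f (2 * (j + 1 : ℕ)) := by
    refine Finset.sum_congr rfl fun j hj => ?_
    rw [Finset.mem_range] at hj
    rw [Nat.choose_symm_of_eq_add (show 2 * i = (i + 1 + j) + (i - 1 - j) by omega), ← hf]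
    congr 2
    push_cast
    ring
  rw [show 2 * i + 1 = i + 1 + i by ring, Finset.sum_range_add, Finset.sum_range_succ, h1, h2,
    sub_self, add_right_comm, ← Finset.sum_add_distrib, add_comm]
  congr 1
  refine Finset.sum_congr rfl fun j _ => ?_
  module

variable {p : ℕ}

/-- Expansion of moments in Chebyshev moments, relative to the moments of the arcsine measure. -/
theorem sub_arcsineSeq_eq_sum {s : ℕ → SymMat p} (hs : (s 0 : Matrix (Fin p) (Fin p) ℝ) = 1)
    (i : ℕ) :
    s i - arcsineSeq p i = ((2 : ℝ) ^ (2 * i))⁻¹ • ∑ j ∈ Finset.range i,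
      (2 * (2 * i).choose (i - 1 - j) : ℝ) •
        evenFunctional s (Chebyshev.T ℝ (2 * (j + 1 : ℕ))) := by
  set d : ℕ → SymMat p := fun i => s i - arcsineSeq p i with hd
  have h0 : evenFunctional d (Chebyshev.T ℝ 0) = 0 := by
    rw [Chebyshev.T_zero, ← pow_zero X, ← Nat.mul_zero 2, evenFunctional_X_pow_two_mul, hd]
    exact sub_eq_zero.2 (Subtype.ext (hs.trans (arcsineSeq_zero p).symm))
  have hX := congrArg (evenFunctional d) (Chebyshev.X_pow_mul_T (2 * i) 0)
  rw [Chebyshev.T_zero, mul_one, evenFunctional_X_pow_two_mul, map_smul, map_sum] at hX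
  simp only [map_smul, zero_add] at hX
  change d i = _
  rw [hX]
  simp only [Nat.cast_mul, Nat.cast_ofNat]
  rw [Finset.sum_range_choose_mul_even (f := fun n => evenFunctional d (Chebyshev.T ℝ n))
    (fun n => by rw [Chebyshev.T_neg]), h0, smul_zero, zero_add]
  congr 1
  refine Finset.sum_congr rfl fun j _ => ?_
  rw [hd, evenFunctional_sub, evenFunctional_arcsineSeq_T (by omega), sub_zero]

section

variable {α : Type*} {l : Filter α} {g : α → ℝ} {S : α → ℕ → SymMat p}
  {W : α → ℕ → Matrix (Fin p) (Fin p) ℝ}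

theorem sub_arcsineSeq_littleO (hS0 : ∀ x, (S x 0 : Matrix (Fin p) (Fin p) ℝ) = 1) {i : ℕ}
    (h : ∀ j < i, EntrywiseLittleO l (fun x =>
      (evenFunctional (S x) (Chebyshev.T ℝ (2 * (j + 1 : ℕ))) : Matrix (Fin p) (Fin p) ℝ) -
        (2 : ℝ) • W x j) g) :
    EntrywiseLittleO l (fun x =>
      (S x i : Matrix (Fin p) (Fin p) ℝ) - (arcsineSeq p i : Matrix (Fin p) (Fin p) ℝ) -
        ((2 : ℝ) ^ (2 * i))⁻¹ • ∑ j ∈ Finset.range i,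
          (4 * (2 * i).choose (i - 1 - j) : ℝ) • W x j) g := by
  refine ((EntrywiseLittleO.sum (Finset.range i) fun j hj =>
    (h j (Finset.mem_range.1 hj)).const_smul (2 * (2 * i).choose (i - 1 - j) : ℝ)).const_smul
      ((2 : ℝ) ^ (2 * i))⁻¹).congr' (Eventually.of_forall fun x => ?_)
  have e := congrArg (Subtype.val : SymMat p → Matrix (Fin p) (Fin p) ℝ)
    (sub_arcsineSeq_eq_sum (hS0 x) i)
  rw [Submodule.coe_sub, Submodule.coe_smul, Submodule.coe_sum] at e
  simp only
  rw [e, ← smul_sub, ← Finset.sum_sub_distrib]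
  congr 1
  refine Finset.sum_congr rfl fun j _ => ?_
  rw [Submodule.coe_smul]
  module

theorem sub_arcsineSeq_bigO (hS0 : ∀ x, (S x 0 : Matrix (Fin p) (Fin p) ℝ) = 1) {i : ℕ}
    (hW : ∀ j < i, EntrywiseBigO l (fun x => W x j) g)
    (h : ∀ j < i, EntrywiseLittleO l (fun x =>
      (evenFunctional (S x) (Chebyshev.T ℝ (2 * (j + 1 : ℕ))) : Matrix (Fin p) (Fin p) ℝ) -
        (2 : ℝ) • W x j) g) :
    EntrywiseBigO l (fun x =>
      (S x i : Matrix (Fin p) (Fin p) ℝ) - (arcsineSeq p i : Matrix (Fin p) (Fin p) ℝ)) g := by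
  refine ((sub_arcsineSeq_littleO hS0 h).bigO.add ((EntrywiseBigO.sum (Finset.range i) fun j hj =>
    (hW j (Finset.mem_range.1 hj)).const_smul (4 * (2 * i).choose (i - 1 - j) : ℝ)).const_smul
      ((2 : ℝ) ^ (2 * i))⁻¹)).congr' (Eventually.of_forall fun x => ?_)
  exact sub_add_cancel _ _

/-- The Chebyshev moments depend to first order only on the canonical moment of the same index. -/
theorem evenFunctional_T_littleO_of_canonicalMoment (hg : Tendsto g l (𝓝 0))
    (hS0 : ∀ x, (S x 0 : Matrix (Fin p) (Fin p) ℝ) = 1) {k : ℕ}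
    (hpos : ∀ᶠ x in l, StrictlyBetween (S x) k)
    (hW : ∀ j < k, EntrywiseBigO l (fun x => W x j) g)
    (hcan : ∀ j < k, ∀ᶠ x in l, canonicalMoment (S x) (j + 1) =
      (1 / 2 : ℝ) • (1 : Matrix (Fin p) (Fin p) ℝ) + W x j) {j : ℕ} (hj : j < k) :
    EntrywiseLittleO l (fun x =>
      (evenFunctional (S x) (Chebyshev.T ℝ (2 * (j + 1 : ℕ))) : Matrix (Fin p) (Fin p) ℝ) -
        (2 : ℝ) • W x j) g := by
  induction j using Nat.strong_induction_on with
  | _ j ih =>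
    -- The earlier Chebyshev moments are already `O(g)`, hence so are the deviations of the moments
    -- up to index `j`, which is all the quadratic defects at `j + 1` require.
    refine evenFunctional_T_sub_littleO hg hS0 (fun i hi => ?_) ?_ (hW j hj) (hcan j hj)
    · exact sub_arcsineSeq_bigO hS0 (fun j' hj' => hW j' (by omega))
        fun j' hj' => ih j' (by omega) (by omega)
    · filter_upwards [hpos] with x hx
      exact (strictlyBetween_iff_hankelPosDef (hS0 x) j).1 (hx.mono hj.le)

end

/-- The coefficient is `4 · 2^{-2i}` in one-based numbering: one factor `2` from folding the
binomial sum, another from `Θ = 2 W`. -/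
theorem sum_arcsineMatrix_smul {k : ℕ} (H : Fin k → SymMat p) (i : Fin k) :
    ∑ j, arcsineMatrix k i j • (H j : Matrix (Fin p) (Fin p) ℝ) =
      ((2 : ℝ) ^ (2 * ((i : ℕ) + 1)))⁻¹ • ∑ j ∈ Finset.range ((i : ℕ) + 1),
        (4 * (2 * ((i : ℕ) + 1)).choose ((i : ℕ) + 1 - 1 - j) : ℝ) •
          (momentSeq H (j + 1) : Matrix (Fin p) (Fin p) ℝ) := by
  set F : ℕ → Matrix (Fin p) (Fin p) ℝ := fun j => (if j ≤ i then
    (2 : ℝ) ^ (-2 * (((i : ℕ) : ℤ) + 1) + 2) * ((2 * ((i : ℕ) + 1)).choose (i - j) : ℝ) else 0) •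
      (momentSeq H (j + 1) : Matrix (Fin p) (Fin p) ℝ) with hF
  have h1 : ∀ j : Fin k, arcsineMatrix k i j • (H j : Matrix (Fin p) (Fin p) ℝ) = F j := by
    intro j
    rw [hF, ← momentSeq_succ H j]
    rfl
  rw [Finset.sum_congr rfl fun j _ => h1 j, Fin.sum_univ_eq_sum_range F k,
    ← Finset.sum_subset (s₁ := Finset.range ((i : ℕ) + 1)), Finset.smul_sum]
  · refine Finset.sum_congr rfl fun j hj => ?_
    rw [Finset.mem_range] at hj
    rw [smul_smul]
    simp only [hF]
    rw [if_pos (by omega), Nat.add_sub_cancel, ← mul_assoc]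
    congr 2
    rw [zpow_add₀ two_ne_zero, neg_mul, zpow_neg]
    norm_cast
  · exact Finset.range_subset_range.2 (by omega)
  · intro j _ hj
    rw [Finset.mem_range] at hj
    simp only [hF]
    rw [if_neg (by omega), zero_smul]

theorem kronecker_one_mul_stackColumn_apply {m n : ℕ} (A : Matrix (Fin m) (Fin n) ℝ)
    (X : Fin n → Matrix (Fin p) (Fin p) ℝ) (i : Fin m) (a b : Fin p) :
    ((A ⊗ₖ (1 : Matrix (Fin p) (Fin p) ℝ)) * stackColumn X) (i, a) b = (∑ j, A i j • X j) a b := by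
  simp [Matrix.mul_apply, Fintype.sum_prod_type, stackColumn, Matrix.kroneckerMap_apply,
    Matrix.sum_apply, Matrix.one_apply]

theorem tendsto_frobNorm_stackColumn {k : ℕ} :
    Tendsto (fun H : Fin k → SymMat p =>
      frobNorm (stackColumn fun i => (H i : Matrix (Fin p) (Fin p) ℝ))) (𝓝 0) (𝓝 0) := by
  have hc : Continuous fun H : Fin k → SymMat p =>
      frobNorm (stackColumn fun i => (H i : Matrix (Fin p) (Fin p) ℝ)) := by
    simp only [frobNorm_eq]
    refine Real.continuous_sqrt.comp (continuous_finsetSum _ fun i _ =>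
      continuous_finsetSum _ fun j _ => ?_)
    exact ((continuous_subtype_val.comp (continuous_apply i.1)).matrix_elem i.2 j).pow 2
  refine (hc.tendsto 0).trans_eq ?_
  simp [frobNorm_eq, stackColumn]

theorem hasMatrixDerivAt_invCanonicalMoments (p k : ℕ) :
    HasMatrixDerivAt (loewnerCube p k)
      (fun U j => (invCanonicalMoments p k U j : Matrix (Fin p) (Fin p) ℝ))
      (arcsineMatrix k ⊗ₖ (1 : Matrix (Fin p) (Fin p) ℝ)) (cubeCenter p k) := by
  refine ⟨isOpen_loewnerCube p k, cubeCenter_mem_loewnerCube p k, ?_⟩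
  set l := 𝓝[{H : Fin k → SymMat p | cubeCenter p k + H ∈ loewnerCube p k}] 0
  have hg := (tendsto_frobNorm_stackColumn (p := p) (k := k)).mono_left
    (nhdsWithin_le_nhds : l ≤ 𝓝 0)
  set g : (Fin k → SymMat p) → ℝ := fun H =>
    frobNorm (stackColumn fun i => (H i : Matrix (Fin p) (Fin p) ℝ)) with hgdef
  set S : (Fin k → SymMat p) → ℕ → SymMat p := fun H =>
    momentSeq (invCanonicalMoments p k (cubeCenter p k + H)) with hSdef
  have hmem : ∀ᶠ H in l, cubeCenter p k + H ∈ loewnerCube p k := self_mem_nhdsWithin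
  have hpos : ∀ᶠ H in l, StrictlyBetween (S H) k := by
    filter_upwards [hmem] with H hH
    have h : invCanonicalMoments p k (cubeCenter p k + H) ∈ interior (momentSpace p k) :=
      Function.invFunOn_mem ((bijOn_canonicalMoments p k).surjOn hH)
    rwa [interior_momentSpace] at h
  -- `momentSeq H (j + 1)` is the increment `H_j` indexed by natural numbers; the entry `1` at index
  -- `0` never occurs.
  have hW : ∀ j < k, EntrywiseBigO l
      (fun H => (momentSeq H (j + 1) : Matrix (Fin p) (Fin p) ℝ)) g := fun j hj a b => by
    refine IsBigO.of_bound 1 (Eventually.of_forall fun H => ?_)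
    beta_reduce
    rw [show momentSeq H (j + 1) = H ⟨j, hj⟩ from momentSeq_succ H ⟨j, hj⟩, one_mul,
      Real.norm_eq_abs]
    exact (abs_le_frobNorm (stackColumn fun i => (H i : Matrix (Fin p) (Fin p) ℝ))
      (⟨j, hj⟩, a) b).trans (le_abs_self _)
  have hcan : ∀ j < k, ∀ᶠ H in l, canonicalMoment (S H) (j + 1) =
      (1 / 2 : ℝ) • (1 : Matrix (Fin p) (Fin p) ℝ) +
        (momentSeq H (j + 1) : Matrix (Fin p) (Fin p) ℝ) := fun j hj => by
    filter_upwards [hmem] with H hH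
    have h1 : canonicalMoments (invCanonicalMoments p k (cubeCenter p k + H)) =
        cubeCenter p k + H := Function.invFunOn_eq ((bijOn_canonicalMoments p k).surjOn hH)
    have h2 := coe_canonicalMoments (invCanonicalMoments p k (cubeCenter p k + H)) ⟨j, hj⟩
    rw [h1] at h2
    rw [show momentSeq H (j + 1) = H ⟨j, hj⟩ from momentSeq_succ H ⟨j, hj⟩]
    exact h2.symm
  refine EntrywiseLittleO.frobNorm fun x b => ?_
  obtain ⟨i, a⟩ := x
  refine (sub_arcsineSeq_littleO (W := fun H j =>
    (momentSeq H (j + 1) : Matrix (Fin p) (Fin p) ℝ)) (fun H => momentSeq_zero _) (i := i + 1)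
    (fun j hj => evenFunctional_T_littleO_of_canonicalMoment hg (fun H => momentSeq_zero _) hpos hW
      hcan (by omega)) a b).congr_left fun H => ?_
  rw [Matrix.sub_apply, kronecker_one_mul_stackColumn_apply, sum_arcsineMatrix_smul,
    invCanonicalMoments_cubeCenter]
  beta_reduce
  rw [momentSeq_succ]
  rfl

end

theorem theorem4p5 (p k : ℕ) :
    Set.BijOn canonicalMoments (interior (momentSpace p k)) (loewnerCube p k) ∧
    HasMatrixDerivAt (loewnerCube p k)
      (fun U j => (invCanonicalMoments p k U j : Matrix (Fin p) (Fin p) ℝ))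
      (arcsineMatrix k ⊗ₖ (1 : Matrix (Fin p) (Fin p) ℝ))
      (cubeCenter p k) :=
  ⟨bijOn_canonicalMoments p k, hasMatrixDerivAt_invCanonicalMoments p k⟩
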